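/- **Conventions.** Let $\mathbb H$ be the quaternions, $\mathbb S=\{J\in\mathbb H: J^2=-1\}$ and $\mathbb C_J=\mathbb R+J\mathbb R$ for $J\in\mathbb S$. A set $\Omega\subseteq\mathbb H$ is *axially symmetric* if $x+Iy\in\Omega$ ($x,y\in\mathbb R$, $I\in\mathbb S$) implies $x+\mathbb S y\subseteq\Omega$. A *basic domain* is a nonempty connected open axially symmetric set $\Omega$ such that, for all $I\in\mathbb S$, every connected component of $\Omega_I=\Omega\cap\mathbb C_I$ is simply connected. For an axially symmetric open set $\Omega$, a function $f:\Omega\to\mathbb H$ is *slice-regular* ($f\in\mathcal{SR}(\Omega)$) if there is a holomorphic $F=F_1+\iota F_2:\{x+iy\in\mathbb C: x+\mathbb S y\subseteq\Omega\}\to\mathbb H\otimes_{\mathbb R}\mathbb C=\mathbb H+\iota\mathbb H$ with $F(\bar z)=\overline{F(z)}$ (where $\overline{a+\iota b}=a-\iota b$) and $f(x+Jy)=F_1(x+iy)+JF_2(x+iy)$ for all $J\in\mathbb S$. The *$*$-product* $f*g$ is the function induced in this way by the product $FG$. We write $\mathcal{SR}_{\mathbb R}(\Omega)$ for the $f\in\mathcal{SR}(\Omega)$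 with $f(\Omega\cap\mathbb C_I)\subseteq\mathbb C_I$ for all $I\in\mathbb S$. Every $f\in\mathcal{SR}(\Omega)$ is uniquely $f=f_0+f_1i+f_2j+f_3k$ with $f_l\in\mathcal{SR}_{\mathbb R}(\Omega)$; its vectorial part is $f_v=f-f_0$, and $f$ is *vectorial* if $f=f_v$. A *$*$-logarithm* of $g$ on $\Omega$ is an $f\in\mathcal{SR}(\Omega)$ with $\exp_*(f)=\sum_{k\ge0}f^{*k}/k!=g$ on $\Omega$. Two vectorial functions $f,h$ on axially symmetric open neighbourhoods of $p$ are *equivalent at $p$* if on some axially symmetric domain $V\ni p$ contained in both of their domains of definition there are $a,b\in\mathcal{SR}_{\mathbb R}(V)$, not both identically zero, with $af+bh=0$, and $f\equiv0$ on $V$ if and only if $h\equiv 0$ on $V$. The equivalence class is denoted $[f]_p$. A *vectorial class* $\omega$ on $\Omega$ assigns to each $p\in\Omega$ such a class $\omega(p)$, in such a way that whenever $\omega(p)=[f]_p$ and $\omega(q)=[h]_q$ with $f,h$ vectorial on axially symmetric domains $V\ni p$, $V'\ni q$ contained in $\Omega$, one has $[f]_r=[h]_r$ for all $r\in V\cap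 V'$. One writes $\omega=[0]$ if $\omega(p)=[0]_p$ for all $p\in\Omega$. $\mathcal{SR}_\omega(\Omega)$ is the set of those $f\in\mathcal{SR}(\Omega)$ such that $f\in\mathcal{SR}_{\mathbb R}(\Omega)$ or $[f_v]_p=\omega(p)$ for all $p\in\Omega$. A *minimal representative* of $\omega$ on an axially symmetric open set $U\subseteq\Omega$ is a vectorial function $w$ on $U$ with $[w]_p=\omega(p)$ for all $p\in U$ which vanishes at no real point of $U$ and identically on no sphere $x+\mathbb S y\subseteq U$, $y\ne0$. $Z(\omega)$ is the union of the zero sets of all minimal representatives of $\omega$ on axially symmetric open subsets of $\Omega$ (so $Z([0])=\varnothing$). **Statement.** Let $\Omega$ be a basic domain, let $g\in\mathcal{SR}_{\mathbb R}(\Omega)$ be nowhere zero on $\Omega$, and let $\omega\ne[0]$ be a vectorial class on $\Omega$ with $Z(\omega)\cap\Omega=\varnothing$. Then $g$ has a $*$-logarithm on $\Omega$ that belongs to $\mathcal{SR}_\omega(\Omega)$. -/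

import Mathlib

/-! Slice-regular functions of a quaternionic variable via stem functions, the `*`-product and the
`*`-exponential, vectorial classes and their zero sets.

`ℍ ⊗ ℂ` is `Quaternion ℂ`; functions on a subset `Ω` of the quaternions are total functions of which
only the values on `Ω` matter. -/

noncomputable section

namespace SliceReg

/-- The `2`-sphere of imaginary units. -/
def imagUnits : Set (Quaternion ℝ) := {J | J * J = -1}

/-- The standard unit `i`. -/
def unitI : Quaternion ℝ := ⟨0, 1, 0, 0⟩

/-- The point `x + J y`, for `z = x + i y`. -/
def slicePoint (J : Quaternion ℝ) (z : ℂ) : Quaternion ℝ :=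
  (z.re : Quaternion ℝ) + J * (z.im : Quaternion ℝ)

/-- The slice `ℂ_J = ℝ + J ℝ`. -/
def slicePlane (J : Quaternion ℝ) : Set (Quaternion ℝ) := Set.range (slicePoint J)

/-- `Ω_J = Ω ∩ ℂ_J`, in the coordinate `x + i y` of `ℂ_J ≅ ℂ`. -/
def sliceSet (J : Quaternion ℝ) (Ω : Set (Quaternion ℝ)) : Set ℂ := {z | slicePoint J z ∈ Ω}

/-- If `x + I y ∈ Ω` then the whole sphere `x + 𝕊 y` is contained in `Ω`. -/
def AxiallySymmetric (Ω : Set (Quaternion ℝ)) : Prop :=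
  ∀ I ∈ imagUnits, ∀ z : ℂ, slicePoint I z ∈ Ω → ∀ J ∈ imagUnits, slicePoint J z ∈ Ω

/-- Axially symmetric open sets. -/
def IsAxOpen (Ω : Set (Quaternion ℝ)) : Prop := IsOpen Ω ∧ AxiallySymmetric Ω

/-- Axially symmetric domains (a domain is open, connected and nonempty). -/
def IsAxDomain (Ω : Set (Quaternion ℝ)) : Prop := IsAxOpen Ω ∧ IsConnected Ω

/-- Basic domains: axially symmetric domains such that every connected component of every slice
`Ω_I` is simply connected. -/
def IsBasicDomain (Ω : Set (Quaternion ℝ)) : Prop :=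
  IsAxDomain Ω ∧ ∀ I ∈ imagUnits, ∀ z ∈ sliceSet I Ω,
    IsSimplyConnected (connectedComponentIn (sliceSet I Ω) z)

/-! ### Stem functions and slice functions -/

/-- The first component `a` of `a + ι b ∈ ℍ + ι ℍ`. -/
def rePart (Z : Quaternion ℂ) : Quaternion ℝ := ⟨Z.re.re, Z.imI.re, Z.imJ.re, Z.imK.re⟩

/-- The second component `b` of `a + ι b ∈ ℍ + ι ℍ`. -/
def imPart (Z : Quaternion ℂ) : Quaternion ℝ := ⟨Z.re.im, Z.imI.im, Z.imJ.im, Z.imK.im⟩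

/-- The element `a + ι b` of `ℍ + ι ℍ`. -/
def mkC (a b : Quaternion ℝ) : Quaternion ℂ :=
  ⟨⟨a.re, b.re⟩, ⟨a.imI, b.imI⟩, ⟨a.imJ, b.imJ⟩, ⟨a.imK, b.imK⟩⟩

/-- The involution `a + ι b ↦ a - ι b`. -/
def conjC (Z : Quaternion ℂ) : Quaternion ℂ := mkC (rePart Z) (-imPart Z)

/-- `φ_J (a + ι b) = a + J b`. -/
def phi (J : Quaternion ℝ) (Z : Quaternion ℂ) : Quaternion ℝ := rePart Z + J * imPart Z

/-- `F` is a stem function on `Ω_i`. -/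
def IsStem (Ω : Set (Quaternion ℝ)) (F : ℂ → Quaternion ℂ) : Prop :=
  ∀ z ∈ sliceSet unitI Ω, F (starRingEnd ℂ z) = conjC (F z)

/-- `F` is holomorphic on `Ω_i` (all four complex components are). -/
def IsHolo (Ω : Set (Quaternion ℝ)) (F : ℂ → Quaternion ℂ) : Prop :=
  DifferentiableOn ℂ (fun z => (F z).re) (sliceSet unitI Ω) ∧
  DifferentiableOn ℂ (fun z => (F z).imI) (sliceSet unitI Ω) ∧
  DifferentiableOn ℂ (fun z => (F z).imJ) (sliceSet unitI Ω) ∧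
  DifferentiableOn ℂ (fun z => (F z).imK) (sliceSet unitI Ω)

/-- On `Ω`, `f` is the slice function induced by `F`: `f ∘ φ_J = φ_J ∘ F` for all `J`. -/
def Induces (Ω : Set (Quaternion ℝ)) (F : ℂ → Quaternion ℂ) (f : Quaternion ℝ → Quaternion ℝ) :
    Prop :=
  ∀ z ∈ sliceSet unitI Ω, ∀ J ∈ imagUnits, f (slicePoint J z) = phi J (F z)

/-- The slice function `𝒥(F)` induced by a stem function `F`: at `q = x + J y` with `y ≥ 0` it is
`φ_J (F (x + i y))`. -/
def induced (F : ℂ → Quaternion ℂ) (q : Quaternion ℝ) : Quaternion ℝ :=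
  phi (‖q.im‖⁻¹ • q.im) (F ⟨q.re, ‖q.im‖⟩)

/-- The stem function of a slice function, by the representation formula on the slice `ℂ_i`. -/
def stem (f : Quaternion ℝ → Quaternion ℝ) (z : ℂ) : Quaternion ℂ :=
  mkC ((2⁻¹ : ℝ) • (f (slicePoint unitI z) + f (slicePoint unitI (starRingEnd ℂ z))))
    (-(unitI * ((2⁻¹ : ℝ) •
      (f (slicePoint unitI z) - f (slicePoint unitI (starRingEnd ℂ z))))))

@[simp] lemma unitI_re : unitI.re = 0 := rfl
@[simp] lemma unitI_imI : unitI.imI = 1 := rfl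
@[simp] lemma unitI_imJ : unitI.imJ = 0 := rfl
@[simp] lemma unitI_imK : unitI.imK = 0 := rfl
@[simp] lemma rePart_re (Z : Quaternion ℂ) : (rePart Z).re = Z.re.re := rfl
@[simp] lemma rePart_imI (Z : Quaternion ℂ) : (rePart Z).imI = Z.imI.re := rfl
@[simp] lemma rePart_imJ (Z : Quaternion ℂ) : (rePart Z).imJ = Z.imJ.re := rfl
@[simp] lemma rePart_imK (Z : Quaternion ℂ) : (rePart Z).imK = Z.imK.re := rfl
@[simp] lemma imPart_re (Z : Quaternion ℂ) : (imPart Z).re = Z.re.im := rfl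
@[simp] lemma imPart_imI (Z : Quaternion ℂ) : (imPart Z).imI = Z.imI.im := rfl
@[simp] lemma imPart_imJ (Z : Quaternion ℂ) : (imPart Z).imJ = Z.imJ.im := rfl
@[simp] lemma imPart_imK (Z : Quaternion ℂ) : (imPart Z).imK = Z.imK.im := rfl
@[simp] lemma rePart_mkC (a b : Quaternion ℝ) : rePart (mkC a b) = a := rfl
@[simp] lemma imPart_mkC (a b : Quaternion ℝ) : imPart (mkC a b) = b := rfl
@[simp] lemma mkC_parts (Z : Quaternion ℂ) : mkC (rePart Z) (imPart Z) = Z := rfl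

lemma unitI_mem : unitI ∈ imagUnits := by
  have o0 : (1 : Quaternion ℝ).re = 1 := rfl
  have o1 : (1 : Quaternion ℝ).imI = 0 := rfl
  have o2 : (1 : Quaternion ℝ).imJ = 0 := rfl
  have o3 : (1 : Quaternion ℝ).imK = 0 := rfl
  change unitI * unitI = -1
  ext <;> simp [o0, o1, o2, o3]

lemma neg_mem_imagUnits {J : Quaternion ℝ} (hJ : J ∈ imagUnits) : -J ∈ imagUnits := by
  simpa [imagUnits] using hJ

lemma slicePoint_conj (J : Quaternion ℝ) (z : ℂ) :
    slicePoint J (starRingEnd ℂ z) = slicePoint (-J) z := by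
  simp [slicePoint]

lemma imagUnits_iff {J : Quaternion ℝ} : J ∈ imagUnits ↔ J.re = 0 ∧ ‖J‖ = 1 := by
  have key : ‖J‖ * ‖J‖ = J.re * J.re + J.imI * J.imI + J.imJ * J.imJ + J.imK * J.imK := by
    rw [← Quaternion.normSq_eq_norm_mul_self, Quaternion.normSq_def']; ring
  have o0 : (1 : Quaternion ℝ).re = 1 := rfl
  have o1 : (1 : Quaternion ℝ).imI = 0 := rfl
  have o2 : (1 : Quaternion ℝ).imJ = 0 := rfl
  have o3 : (1 : Quaternion ℝ).imK = 0 := rfl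
  constructor
  · intro h
    have h' : J * J = -1 := h
    have hn : ‖J‖ * ‖J‖ = 1 := by rw [← norm_mul, h']; simp
    have e0 : (J * J).re = (-1 : Quaternion ℝ).re := by rw [h']
    rw [Quaternion.re_mul, Quaternion.re_neg, o0] at e0
    refine ⟨?_, by nlinarith [norm_nonneg J]⟩
    have : J.re * J.re = 0 := by linarith
    simpa using this
  · rintro ⟨h0, h1⟩
    rw [h1, h0] at key
    change J * J = -1
    ext
    · rw [Quaternion.re_mul, Quaternion.re_neg, o0, h0]; linarith
    · rw [Quaternion.imI_mul, Quaternion.imI_neg, o1, h0]; ring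
    · rw [Quaternion.imJ_mul, Quaternion.imJ_neg, o2, h0]; ring
    · rw [Quaternion.imK_mul, Quaternion.imK_neg, o3, h0]; ring

lemma phi_conjC (J : Quaternion ℝ) (Z : Quaternion ℂ) : phi J (conjC Z) = phi (-J) Z := by
  simp [phi, conjC]

lemma slicePoint_re {J : Quaternion ℝ} (hJ : J ∈ imagUnits) (z : ℂ) :
    (slicePoint J z).re = z.re := by
  simp [slicePoint, (imagUnits_iff.1 hJ).1]

lemma slicePoint_im {J : Quaternion ℝ} (hJ : J ∈ imagUnits) (z : ℂ) :
    (slicePoint J z).im = z.im • J := by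
  ext <;> simp [slicePoint, (imagUnits_iff.1 hJ).1, mul_comm]

/-- `stem f` is the stem function that induces `f`. -/
lemma stem_eq {Ω : Set (Quaternion ℝ)} {F : ℂ → Quaternion ℂ} {f : Quaternion ℝ → Quaternion ℝ}
    (h : Induces Ω F f) {z : ℂ} (hz : z ∈ sliceSet unitI Ω) : stem f z = F z := by
  have h1 := h z hz unitI unitI_mem
  have h2 := h z hz (-unitI) (neg_mem_imagUnits unitI_mem)
  rw [← slicePoint_conj] at h2
  have hu : unitI * unitI = -1 := unitI_mem
  have e1 : (2⁻¹ : ℝ) • (phi unitI (F z) + phi (-unitI) (F z)) = rePart (F z) := by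
    simp only [phi, neg_mul]
    module
  have e2 : (2⁻¹ : ℝ) • (phi unitI (F z) - phi (-unitI) (F z)) = unitI * imPart (F z) := by
    simp only [phi, neg_mul]
    module
  rw [stem, h1, h2, e1, e2, ← mul_assoc, hu]
  simp

/-- `𝒥(F)` is induced by `F`. -/
lemma induces_induced {Ω : Set (Quaternion ℝ)} {F : ℂ → Quaternion ℂ} (hF : IsStem Ω F) :
    Induces Ω F (induced F) := by
  intro z hz J hJ
  obtain ⟨-, hJ1⟩ := imagUnits_iff.1 hJ
  rw [induced, slicePoint_re hJ, slicePoint_im hJ, norm_smul, hJ1, mul_one, Real.norm_eq_abs]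
  rcases lt_trichotomy z.im 0 with hy | hy | hy
  · have e : (⟨z.re, |z.im|⟩ : ℂ) = starRingEnd ℂ z := by
      apply Complex.ext <;> simp [abs_of_neg hy]
    rw [e, hF z hz, phi_conjC, abs_of_neg hy, smul_smul]
    congr 1
    rw [inv_neg, neg_mul, inv_mul_cancel₀ hy.ne]
    simp
  · have hc : starRingEnd ℂ z = z := by apply Complex.ext <;> simp [hy]
    have h0 : imPart (F z) = 0 := by
      have h1 := congrArg imPart (hF z hz)
      rw [hc, conjC, imPart_mkC] at h1
      have h2 : (2 : ℝ) • imPart (F z) = 0 := by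
        rw [two_smul]
        nth_rewrite 1 [h1]
        simp
      simpa using h2
    have e : (⟨z.re, |z.im|⟩ : ℂ) = z := by apply Complex.ext <;> simp [hy]
    rw [e]
    simp [phi, h0]
  · have e : (⟨z.re, |z.im|⟩ : ℂ) = z := by apply Complex.ext <;> simp [abs_of_pos hy]
    rw [e, abs_of_pos hy, smul_smul, inv_mul_cancel₀ hy.ne', one_smul]

/-! ### Slice-regular functions -/

/-- `𝒮ℛ(Ω)`. -/
def SR (Ω : Set (Quaternion ℝ)) : Set (Quaternion ℝ → Quaternion ℝ) :=
  {f | ∃ F, IsStem Ω F ∧ IsHolo Ω F ∧ Induces Ω F f}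

/-- `𝒮ℛ_ℝ(Ω)`: slice-regular functions that map every slice `Ω_I` into `ℂ_I`. -/
def SRReal (Ω : Set (Quaternion ℝ)) : Set (Quaternion ℝ → Quaternion ℝ) :=
  {f | f ∈ SR Ω ∧ ∀ I ∈ imagUnits, ∀ q ∈ Ω ∩ slicePlane I, f q ∈ slicePlane I}

/-- The scalar part `f₀` in the decomposition `f = f₀ + f₁ i + f₂ j + f₃ k`, where `f₀, …, f₃` are
induced by the complex components of the stem function of `f`. -/
def scalarPart (f : Quaternion ℝ → Quaternion ℝ) : Quaternion ℝ → Quaternion ℝ :=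
  induced fun z => (((stem f z).re : ℂ) : Quaternion ℂ)

/-- The vectorial part `f_v = f - f₀`. -/
def vecPart (f : Quaternion ℝ → Quaternion ℝ) : Quaternion ℝ → Quaternion ℝ :=
  fun q => f q - scalarPart f q

/-- `𝒮ℛᵛ(Ω)`: slice-regular functions with `f = f_v` on `Ω`. -/
def SRVec (Ω : Set (Quaternion ℝ)) : Set (Quaternion ℝ → Quaternion ℝ) :=
  {f | f ∈ SR Ω ∧ ∀ q ∈ Ω, f q = vecPart f q}

/-! ### `*`-product and `*`-exponential -/

/-- `f * g = 𝒥(FG)`. -/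
def starMul (f g : Quaternion ℝ → Quaternion ℝ) : Quaternion ℝ → Quaternion ℝ :=
  induced fun z => stem f z * stem g z

/-- The `*`-powers `f^{*k}`. -/
def starPow (f : Quaternion ℝ → Quaternion ℝ) : ℕ → Quaternion ℝ → Quaternion ℝ
  | 0 => fun _ => 1
  | k + 1 => starMul (starPow f k) f

/-- `exp_* f = g` on `Ω`, where `exp_* f = ∑ f^{*k} / k!`; that is, `f` is a `*`-logarithm of `g`
on `Ω`. -/
def IsStarLog (Ω : Set (Quaternion ℝ)) (f g : Quaternion ℝ → Quaternion ℝ) : Prop :=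
  ∀ q ∈ Ω, HasSum (fun k : ℕ => ((Nat.factorial k : ℝ)⁻¹) • starPow f k q) (g q)

/-! ### Vectorial classes -/

/-- Linear dependence over `𝒮ℛ_ℝ(V)`. -/
def LinDep (V : Set (Quaternion ℝ)) (f g : Quaternion ℝ → Quaternion ℝ) : Prop :=
  ∃ a ∈ SRReal V, ∃ b ∈ SRReal V, ((∃ q ∈ V, a q ≠ 0) ∨ ∃ q ∈ V, b q ≠ 0) ∧
    ∀ q ∈ V, a q * f q + b q * g q = 0

/-- `f` on `U` and `g` on `U'` are equivalent at `p`: they are linearly dependent on an axially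
symmetric domain `V ∋ p`. As the null function depends linearly on every function, it has to be
equivalent to itself only, for otherwise this is not an equivalence relation. -/
def EquivAt (p : Quaternion ℝ) (U : Set (Quaternion ℝ)) (f : Quaternion ℝ → Quaternion ℝ)
    (U' : Set (Quaternion ℝ)) (g : Quaternion ℝ → Quaternion ℝ) : Prop :=
  ∃ V, IsAxDomain V ∧ p ∈ V ∧ V ⊆ U ∩ U' ∧ LinDep V f g ∧
    ((∀ q ∈ V, f q = 0) ↔ ∀ q ∈ V, g q = 0)

/-- A vectorial function near `p`: its axially symmetric open domain, and the function. -/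
def IsLocalVec (p : Quaternion ℝ)
    (P : Set (Quaternion ℝ) × (Quaternion ℝ → Quaternion ℝ)) : Prop :=
  IsAxOpen P.1 ∧ p ∈ P.1 ∧ P.2 ∈ SRVec P.1

/-- The equivalence class `[f]_p` of `f : U → ℍ`. -/
def vecClass (p : Quaternion ℝ) (U : Set (Quaternion ℝ)) (f : Quaternion ℝ → Quaternion ℝ) :
    Set (Set (Quaternion ℝ) × (Quaternion ℝ → Quaternion ℝ)) :=
  {P | IsLocalVec p P ∧ EquivAt p U f P.1 P.2}

/-- Vectorial classes on `Ω`: to each `p ∈ Ω` an equivalence class `[f]_p` is assigned, such that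
representatives of the classes at `p` and `q` on domains `V, V' ⊆ Ω` are equivalent at all points
of `V ∩ V'`. -/
structure VectorialClass (Ω : Set (Quaternion ℝ)) where
  /-- the class at a point; the values outside `Ω` are irrelevant -/
  cls : Quaternion ℝ → Set (Set (Quaternion ℝ) × (Quaternion ℝ → Quaternion ℝ))
  isClass : ∀ p ∈ Ω, ∃ U f, IsLocalVec p (U, f) ∧ cls p = vecClass p U f
  compat : ∀ p ∈ Ω, ∀ q ∈ Ω, ∀ V f V' g, IsAxDomain V → IsAxDomain V' → V ⊆ Ω → V' ⊆ Ω →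
    (V, f) ∈ cls p → (V', g) ∈ cls q → ∀ r ∈ V ∩ V', EquivAt r V f V' g

/-- `ω = [0]`. -/
def VectorialClass.IsNull {Ω : Set (Quaternion ℝ)} (ω : VectorialClass Ω) : Prop :=
  ∀ p ∈ Ω, ω.cls p = vecClass p Set.univ (fun _ => 0)

/-- `𝒮ℛ_ω(Ω)`: slice-regular functions whose vectorial part belongs to `ω` at all points of `Ω`;
every `𝒮ℛ_ω(Ω)` also contains `𝒮ℛ_ℝ(Ω)`. -/
def SRClass {Ω : Set (Quaternion ℝ)} (ω : VectorialClass Ω) :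
    Set (Quaternion ℝ → Quaternion ℝ) :=
  {f | f ∈ SR Ω ∧ ((∀ p ∈ Ω, (Ω, vecPart f) ∈ ω.cls p) ∨ f ∈ SRReal Ω)}

/-- `w` is a minimal representative of `ω` on `U`: it has neither real zeros nor spherical zeros
(spheres `x + 𝕊 y`, `y ≠ 0`, on which it vanishes identically). -/
def IsMinimalRep {Ω : Set (Quaternion ℝ)} (ω : VectorialClass Ω) (U : Set (Quaternion ℝ))
    (w : Quaternion ℝ → Quaternion ℝ) : Prop :=
  w ∈ SRVec U ∧ (∀ p ∈ U, (U, w) ∈ ω.cls p) ∧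
  (∀ x : ℝ, (x : Quaternion ℝ) ∈ U → w (x : Quaternion ℝ) ≠ 0) ∧
  ∀ z ∈ sliceSet unitI U, z.im ≠ 0 → ∃ J ∈ imagUnits, w (slicePoint J z) ≠ 0

/-- `Z(ω)`: the union of the zero sets of the minimal representatives of `ω` on axially symmetric
open subsets of `Ω`. It is empty for `ω = [0]`, which has no minimal representative. -/
def VectorialClass.zeroSet {Ω : Set (Quaternion ℝ)} (ω : VectorialClass Ω) :
    Set (Quaternion ℝ) :=
  {q | ∃ U w, IsAxOpen U ∧ U ⊆ Ω ∧ IsMinimalRep ω U w ∧ q ∈ U ∧ w q = 0}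

end SliceReg

end

noncomputable section

namespace SliceReg

open Filter Topology

/-! ### Coordinates on axially symmetric sets -/

/-! Everything is transported to stem functions on the symmetric open set `D = sliceSet unitI Ω`.
There `g` becomes a nowhere zero holomorphic scalar `G` with `G (z̄)` conjugate to `G z`, and a
vectorial function becomes a symmetric holomorphic map into `ℂ³`.

If `D` misses the real axis, its upper half is simply connected; a logarithm of `G` there, reflected
to the lower half, is a slice-preserving solution. If `D` meets the real axis, `D` itself is simply
connected and `G` is real and nonzero at a real point `x`. For `G x > 0` the logarithm that is real
at `x` is symmetric by the identity theorem (`exists_log_stem_of_pos`), so `ω` plays no role.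

For `G x < 0` a symmetric scalar logarithm would be real at `x`, which is impossible. Instead take
`L` with `exp L = -G` and a vectorial `v` with `v ⬝ v = 1`. In the quaternions `v² = -1`, hence `exp
(π v) = -1`, and `L + π v` is a logarithm of `G` (`isStarLog_add_pi`). It remains to find such a `v`
in `ω`, and this is where `Z(ω) = ∅` enters.

Near a point, dividing a representative by its order of vanishing gives a nowhere zero `W`
(`exists_local_factorization`). If `W ⬝ W` vanished, `W` would vanish at a point of the
corresponding sphere (`exists_phi_eq_zero`), and this point would lie in `Z(ω)`. So `W` can be
divided by a local square root of `W ⬝ W`, and the resulting unit field depends on `ω` only up to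
sign. The signs are chosen coherently by lifting through the double cover of the quadric modulo `±1`
(`exists_global_unit`). The conjugate reflection of `v` is `v` or `-v`; the second would make `v`
purely imaginary at `x`, contradicting `v ⬝ v = 1` (`exists_unit_stem`). -/

/-- The point `x + i |y|` of the closed upper half plane, for `z = x + i y`. -/
def fold (z : ℂ) : ℂ := ⟨z.re, |z.im|⟩

/-- The coordinate `x + i y`, `y ≥ 0`, of a quaternion `x + J y`. -/
def sliceCoord (q : Quaternion ℝ) : ℂ := ⟨q.re, ‖q.im‖⟩

lemma fold_eq_or (z : ℂ) : fold z = z ∨ fold z = star z := by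
  rcases le_total 0 z.im with h | h
  · left; apply Complex.ext <;> simp [fold, abs_of_nonneg h]
  · right; apply Complex.ext <;> simp [fold, abs_of_nonpos h]

lemma fold_of_nonneg {z : ℂ} (h : 0 ≤ z.im) : fold z = z := by
  apply Complex.ext <;> simp [fold, abs_of_nonneg h]

lemma sliceCoord_slicePoint {J : Quaternion ℝ} (hJ : J ∈ imagUnits) (z : ℂ) :
    sliceCoord (slicePoint J z) = fold z := by
  rw [sliceCoord, slicePoint_re hJ, slicePoint_im hJ, norm_smul, (imagUnits_iff.1 hJ).2]
  simp [fold]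

lemma exists_slicePoint_eq (q : Quaternion ℝ) :
    ∃ J ∈ imagUnits, q = slicePoint J (sliceCoord q) := by
  by_cases h : ‖q.im‖ = 0
  · refine ⟨unitI, unitI_mem, ?_⟩
    have h' : q.im = 0 := by simpa using h
    have := q.re_add_im
    rw [h', add_zero] at this
    simp [slicePoint, sliceCoord, h', this]
  · refine ⟨‖q.im‖⁻¹ • q.im, imagUnits_iff.2 ⟨by simp, ?_⟩, ?_⟩
    · rw [norm_smul, norm_inv, norm_norm, inv_mul_cancel₀ h]
    · have h2 : (‖q.im‖⁻¹ • q.im) * ((‖q.im‖ : ℝ) : Quaternion ℝ) = q.im := by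
        rw [← Quaternion.coe_commutes, Quaternion.coe_mul_eq_smul, smul_smul, mul_inv_cancel₀ h,
          one_smul]
      rw [slicePoint, sliceCoord, h2, q.re_add_im]

lemma slicePoint_star (J : Quaternion ℝ) (z : ℂ) : slicePoint J (star z) = slicePoint (-J) z :=
  slicePoint_conj J z

lemma slicePoint_mem_iff {Ω : Set (Quaternion ℝ)} (h : AxiallySymmetric Ω) {J : Quaternion ℝ}
    (hJ : J ∈ imagUnits) {z : ℂ} : slicePoint J z ∈ Ω ↔ z ∈ sliceSet unitI Ω :=
  ⟨fun hz => h J hJ z hz _ unitI_mem, fun hz => h _ unitI_mem z hz J hJ⟩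

lemma star_mem_iff {Ω : Set (Quaternion ℝ)} (h : AxiallySymmetric Ω) {z : ℂ} :
    star z ∈ sliceSet unitI Ω ↔ z ∈ sliceSet unitI Ω := by
  rw [← slicePoint_mem_iff h unitI_mem, slicePoint_star,
    slicePoint_mem_iff h (neg_mem_imagUnits unitI_mem)]

lemma fold_mem_iff {Ω : Set (Quaternion ℝ)} (h : AxiallySymmetric Ω) {z : ℂ} :
    fold z ∈ sliceSet unitI Ω ↔ z ∈ sliceSet unitI Ω := by
  rcases fold_eq_or z with e | e <;> rw [e]
  exact star_mem_iff h

lemma sliceCoord_mem_iff {Ω : Set (Quaternion ℝ)} (h : AxiallySymmetric Ω) {q : Quaternion ℝ} :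
    sliceCoord q ∈ sliceSet unitI Ω ↔ q ∈ Ω := by
  obtain ⟨J, hJ, e⟩ := exists_slicePoint_eq q
  conv_rhs => rw [e]
  exact (slicePoint_mem_iff h hJ).symm

lemma continuous_slicePoint : Continuous fun p : Quaternion ℝ × ℂ => slicePoint p.1 p.2 := by
  have h : Continuous fun x : ℝ => (x : Quaternion ℝ) := Quaternion.continuous_coe
  unfold slicePoint
  exact (h.comp (Complex.continuous_re.comp continuous_snd)).add
    (continuous_fst.mul (h.comp (Complex.continuous_im.comp continuous_snd)))

lemma continuous_sliceCoord : Continuous sliceCoord := by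
  have h : sliceCoord = fun q => (q.re : ℂ) + (‖q.im‖ : ℂ) * Complex.I := by
    funext q; apply Complex.ext <;> simp [sliceCoord]
  rw [h]
  have h1 : Continuous fun q : Quaternion ℝ => q.re := Quaternion.continuous_re
  have h2 : Continuous fun q : Quaternion ℝ => q.im := Quaternion.continuous_im
  fun_prop

lemma isOpen_sliceSet {Ω : Set (Quaternion ℝ)} (h : IsOpen Ω) (J : Quaternion ℝ) :
    IsOpen (sliceSet J Ω) :=
  h.preimage (continuous_slicePoint.comp (Continuous.prodMk_right J))

lemma sliceSet_nonempty {Ω : Set (Quaternion ℝ)} (h : AxiallySymmetric Ω) (hne : Ω.Nonempty) :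
    (sliceSet unitI Ω).Nonempty :=
  hne.elim fun _ hq => ⟨_, (sliceCoord_mem_iff h).2 hq⟩

/-! ### Small axially symmetric domains -/

/-- The axially symmetric set with coordinates in the disc of radius `r` about `x + i |y|`. -/
def axBall (z : ℂ) (r : ℝ) : Set (Quaternion ℝ) := {q | sliceCoord q ∈ Metric.ball (fold z) r}

lemma slicePoint_mem_axBall {J : Quaternion ℝ} (hJ : J ∈ imagUnits) {z y : ℂ} {r : ℝ} :
    slicePoint J y ∈ axBall z r ↔ fold y ∈ Metric.ball (fold z) r := by
  rw [axBall, Set.mem_ofPred_eq, sliceCoord_slicePoint hJ]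

lemma mem_sliceSet_axBall {z y : ℂ} {r : ℝ} :
    y ∈ sliceSet unitI (axBall z r) ↔ fold y ∈ Metric.ball (fold z) r :=
  slicePoint_mem_axBall unitI_mem

lemma isAxOpen_axBall (z : ℂ) (r : ℝ) : IsAxOpen (axBall z r) := by
  refine ⟨Metric.isOpen_ball.preimage continuous_sliceCoord, fun I hI y hy J hJ => ?_⟩
  rw [slicePoint_mem_axBall hI] at hy
  rwa [slicePoint_mem_axBall hJ]

/-- The imaginary units are the isometric linear image of the unit sphere of `ℝ³`, which is
connected because the dimension exceeds one. -/
lemma isConnected_imagUnits : IsConnected imagUnits := by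
  let φ : EuclideanSpace ℝ (Fin 3) → Quaternion ℝ := fun v => ⟨0, v 0, v 1, v 2⟩
  have hφ : Continuous φ := by
    have : φ = fun v => (v 0) • (⟨0, 1, 0, 0⟩ : Quaternion ℝ) + (v 1) • (⟨0, 0, 1, 0⟩ : Quaternion ℝ)
        + (v 2) • (⟨0, 0, 0, 1⟩ : Quaternion ℝ) := by
      funext v; ext <;> simp [φ]
    rw [this]
    have hc (i : Fin 3) : Continuous fun v : EuclideanSpace ℝ (Fin 3) => v i := by fun_prop
    exact (((hc 0).smul continuous_const).add ((hc 1).smul continuous_const)).add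
      ((hc 2).smul continuous_const)
  have hn (v) : ‖φ v‖ = ‖v‖ := by
    rw [EuclideanSpace.norm_eq, ← Real.sqrt_sq (norm_nonneg (φ v)), sq,
      ← Quaternion.normSq_eq_norm_mul_self, Quaternion.normSq_def', Fin.sum_univ_three]
    simp [φ]
  have hrank : 1 < Module.rank ℝ (EuclideanSpace ℝ (Fin 3)) := by
    rw [← Module.finrank_eq_rank, finrank_euclideanSpace_fin]; norm_num
  have hS := (isConnected_sphere hrank 0 zero_le_one).image φ hφ.continuousOn
  convert hS
  ext J
  rw [imagUnits_iff]
  constructor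
  · rintro ⟨h0, h1⟩
    have e : φ !₂[J.imI, J.imJ, J.imK] = J := by ext <;> simp [φ, h0]
    exact ⟨_, by rw [mem_sphere_zero_iff_norm, ← hn, e, h1], e⟩
  · rintro ⟨v, hv, rfl⟩
    exact ⟨rfl, by rw [hn]; simpa using hv⟩

/-- The set is the image of `𝕊` times a half disc, a product of connected sets. It is connected even
when its slice consists of two disjoint discs. -/
lemma isAxDomain_axBall (z : ℂ) {r : ℝ} (hr : 0 < r) : IsAxDomain (axBall z r) := by
  refine ⟨isAxOpen_axBall z r, ?_⟩
  have hconv : IsConnected (Metric.ball (fold z) r ∩ {y : ℂ | 0 ≤ y.im}) :=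
    ⟨⟨fold z, by simp [hr], by simp [fold]⟩,
      ((convex_ball (fold z) r).inter (convex_halfSpace_im_ge 0)).isPreconnected⟩
  have h := (isConnected_imagUnits.prod hconv).image _ continuous_slicePoint.continuousOn
  convert h
  ext q
  constructor
  · intro hq
    obtain ⟨J, hJ, e⟩ := exists_slicePoint_eq q
    exact ⟨(J, sliceCoord q), ⟨hJ, hq, norm_nonneg _⟩, e.symm⟩
  · rintro ⟨⟨J, y⟩, ⟨hJ, hy, hy'⟩, rfl⟩
    rw [slicePoint_mem_axBall hJ, fold_of_nonneg hy']
    exact hy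

lemma exists_axBall_subset {U : Set (Quaternion ℝ)} (hU : IsAxOpen U) {z : ℂ}
    (hz : z ∈ sliceSet unitI U) :
    ∃ r > 0, axBall z r ⊆ U := by
  obtain ⟨r, hr, h⟩ := Metric.isOpen_iff.1 (isOpen_sliceSet hU.1 unitI) _ ((fold_mem_iff hU.2).2 hz)
  exact ⟨r, hr, fun q hq => (sliceCoord_mem_iff hU.2).1 (h hq)⟩

lemma slicePoint_self_mem_axBall {J : Quaternion ℝ} (hJ : J ∈ imagUnits) (z : ℂ) {r : ℝ}
    (hr : 0 < r) : slicePoint J z ∈ axBall z r := by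
  rw [slicePoint_mem_axBall hJ]; exact Metric.mem_ball_self hr

/-! ### Scalar and vectorial stem functions -/

/-- The element `v₀ i + v₁ j + v₂ k` of `ℍ ⊗ ℂ`. -/
def ofVec (v : Fin 3 → ℂ) : Quaternion ℂ := ⟨0, v 0, v 1, v 2⟩

/-- The vectorial components of an element of `ℍ ⊗ ℂ`. -/
def toVec (Z : Quaternion ℂ) : Fin 3 → ℂ := ![Z.imI, Z.imJ, Z.imK]

@[simp] lemma ofVec_re (v : Fin 3 → ℂ) : (ofVec v).re = 0 := rfl
@[simp] lemma ofVec_imI (v : Fin 3 → ℂ) : (ofVec v).imI = v 0 := rfl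
@[simp] lemma ofVec_imJ (v : Fin 3 → ℂ) : (ofVec v).imJ = v 1 := rfl
@[simp] lemma ofVec_imK (v : Fin 3 → ℂ) : (ofVec v).imK = v 2 := rfl
@[simp] lemma toVec_ofVec (v : Fin 3 → ℂ) : toVec (ofVec v) = v := by
  funext i; fin_cases i <;> rfl

lemma ofVec_toVec {Z : Quaternion ℂ} (h : Z.re = 0) : ofVec (toVec Z) = Z := by
  ext <;> simp [toVec, h]

/-- Holomorphic functions `A` on `D` with `A (z̄)` conjugate to `A z`. -/
def IsHoloStem {E : Type*} [NormedAddCommGroup E] [NormedSpace ℂ E] [Star E] (D : Set ℂ)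
    (A : ℂ → E) : Prop :=
  DifferentiableOn ℂ A D ∧ ∀ z ∈ D, A (star z) = star (A z)

section Components

variable {R : Type*} [CommRing R]

@[simp] lemma quaternion_zero_re : (0 : Quaternion R).re = 0 := rfl
@[simp] lemma quaternion_zero_imI : (0 : Quaternion R).imI = 0 := rfl
@[simp] lemma quaternion_zero_imJ : (0 : Quaternion R).imJ = 0 := rfl
@[simp] lemma quaternion_zero_imK : (0 : Quaternion R).imK = 0 := rfl
@[simp] lemma quaternion_one_re : (1 : Quaternion R).re = 1 := rfl
@[simp] lemma quaternion_one_imI : (1 : Quaternion R).imI = 0 := rfl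
@[simp] lemma quaternion_one_imJ : (1 : Quaternion R).imJ = 0 := rfl
@[simp] lemma quaternion_one_imK : (1 : Quaternion R).imK = 0 := rfl

end Components

@[simp] lemma conjC_re (Z : Quaternion ℂ) : (conjC Z).re = star Z.re := by
  apply Complex.ext <;> simp [conjC, mkC]
@[simp] lemma conjC_imI (Z : Quaternion ℂ) : (conjC Z).imI = star Z.imI := by
  apply Complex.ext <;> simp [conjC, mkC]
@[simp] lemma conjC_imJ (Z : Quaternion ℂ) : (conjC Z).imJ = star Z.imJ := by
  apply Complex.ext <;> simp [conjC, mkC]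
@[simp] lemma conjC_imK (Z : Quaternion ℂ) : (conjC Z).imK = star Z.imK := by
  apply Complex.ext <;> simp [conjC, mkC]

/-- The standard unit `j`. -/
def unitJ : Quaternion ℝ := ⟨0, 0, 1, 0⟩

@[simp] lemma unitJ_re : unitJ.re = 0 := rfl
@[simp] lemma unitJ_imI : unitJ.imI = 0 := rfl
@[simp] lemma unitJ_imJ : unitJ.imJ = 1 := rfl
@[simp] lemma unitJ_imK : unitJ.imK = 0 := rfl

lemma unitJ_mem : unitJ ∈ imagUnits := by
  change unitJ * unitJ = -1
  ext <;> simp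

lemma conjC_coe (c : ℂ) : conjC (c : Quaternion ℂ) = ((star c : ℂ) : Quaternion ℂ) := by
  ext <;> simp

lemma conjC_ofVec (v : Fin 3 → ℂ) : conjC (ofVec v) = ofVec (star v) := by
  ext <;> simp

lemma conjC_mul (Z W : Quaternion ℂ) : conjC (Z * W) = conjC Z * conjC W := by
  ext <;> simp

lemma conjC_add (Z W : Quaternion ℂ) : conjC (Z + W) = conjC Z + conjC W := by
  ext <;> simp

@[simp] lemma phi_zero (J : Quaternion ℝ) : phi J 0 = 0 := by
  ext <;> simp [phi]

lemma phi_add (J : Quaternion ℝ) (Z W : Quaternion ℂ) : phi J (Z + W) = phi J Z + phi J W := by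
  have h1 : rePart (Z + W) = rePart Z + rePart W := by ext <;> simp
  have h2 : imPart (Z + W) = imPart Z + imPart W := by ext <;> simp
  simp only [phi, h1, h2, mul_add]; abel

/-- Multiplicativity of `phi J` holds here because the real coefficients of the left factor `c`
commute with everything; for a general left factor it fails. -/
lemma phi_coe_mul {J : Quaternion ℝ} (hJ : J ∈ imagUnits) (c : ℂ) (Z : Quaternion ℂ) :
    phi J (c * Z) = phi J (c : Quaternion ℂ) * phi J Z := by
  have hJ' : J * J = -1 := hJ
  have h1 : rePart (c * Z) = c.re • rePart Z - c.im • imPart Z := by ext <;> simp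
  have h2 : imPart (c * Z) = c.re • imPart Z + c.im • rePart Z := by ext <;> simp
  have h3 : rePart (c : Quaternion ℂ) = (c.re : Quaternion ℝ) := by ext <;> simp
  have h4 : imPart (c : Quaternion ℂ) = (c.im : Quaternion ℝ) := by ext <;> simp
  have e (a : ℝ) (X : Quaternion ℝ) : J * a * X = a • (J * X) := by
    rw [Quaternion.mul_coe_eq_smul, smul_mul_assoc]
  have e' : J * (J * imPart Z) = -imPart Z := by rw [← mul_assoc, hJ', neg_one_mul]
  rw [phi, phi, phi, h1, h2, h3, h4, add_mul, e, Quaternion.coe_mul_eq_smul, mul_add, mul_add,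
    mul_smul_comm, mul_smul_comm, e']
  module

lemma phi_coe (J : Quaternion ℝ) (c : ℂ) : phi J (c : Quaternion ℂ) = slicePoint J c := by
  have h3 : rePart (c : Quaternion ℂ) = (c.re : Quaternion ℝ) := by ext <;> simp
  have h4 : imPart (c : Quaternion ℂ) = (c.im : Quaternion ℝ) := by ext <;> simp
  rw [phi, h3, h4, slicePoint]

lemma eq_zero_of_phi_eq_zero {J : Quaternion ℝ} (hJ : J ∈ imagUnits) {Z : Quaternion ℂ}
    (h1 : phi J Z = 0) (h2 : phi (-J) Z = 0) : Z = 0 := by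
  have hJ' : J * J = -1 := hJ
  simp only [phi, neg_mul] at h1 h2
  have ha : rePart Z = 0 := by
    have : (2 : ℝ) • rePart Z = 0 := by
      rw [two_smul]
      calc rePart Z + rePart Z = (rePart Z + J * imPart Z) + (rePart Z + -(J * imPart Z)) := by abel
        _ = 0 := by rw [h1, h2, add_zero]
    simpa using this
  have hb : imPart Z = 0 := by
    rw [ha, zero_add] at h1
    have : J * (J * imPart Z) = 0 := by rw [h1, mul_zero]
    simpa [← mul_assoc, hJ'] using this
  rw [← mkC_parts Z, ha, hb]
  ext <;> rfl

lemma slicePoint_eq_zero_iff {J : Quaternion ℝ} (hJ : J ∈ imagUnits) {c : ℂ} :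
    slicePoint J c = 0 ↔ c = 0 := by
  refine ⟨fun h => ?_, fun h => by simp [h, slicePoint]⟩
  have h1 := slicePoint_re hJ c
  have h2 := slicePoint_im hJ c
  rw [h] at h1 h2
  have h3 := congrArg norm h2
  rw [norm_smul, (imagUnits_iff.1 hJ).2] at h3
  apply Complex.ext
  · simpa using h1.symm
  · have h4 : (0 : Quaternion ℝ).im = 0 := by ext <;> simp
    rw [h4] at h3
    simpa using h3.symm

lemma Induces.zero_iff {Ω : Set (Quaternion ℝ)} (hΩ : AxiallySymmetric Ω) {F : ℂ → Quaternion ℂ}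
    {f : Quaternion ℝ → Quaternion ℝ} (h : Induces Ω F f) :
    (∀ q ∈ Ω, f q = 0) ↔ ∀ z ∈ sliceSet unitI Ω, F z = 0 := by
  constructor
  · intro h0 z hz
    apply eq_zero_of_phi_eq_zero unitI_mem
    · rw [← h z hz _ unitI_mem]; exact h0 _ hz
    · rw [← h z hz _ (neg_mem_imagUnits unitI_mem)]
      exact h0 _ ((slicePoint_mem_iff hΩ (neg_mem_imagUnits unitI_mem)).2 hz)
  · intro h0 q hq
    obtain ⟨J, hJ, e⟩ := exists_slicePoint_eq q
    have hz := (sliceCoord_mem_iff hΩ).2 hq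
    rw [e, h _ hz J hJ, h0 _ hz, phi_zero]

lemma Induces.mono {Ω V : Set (Quaternion ℝ)} (hV : V ⊆ Ω) {F : ℂ → Quaternion ℂ}
    {f : Quaternion ℝ → Quaternion ℝ} (h : Induces Ω F f) : Induces V F f :=
  fun z hz J hJ => h z (hV hz) J hJ

lemma Induces.congr {Ω : Set (Quaternion ℝ)} {F G : ℂ → Quaternion ℂ}
    {f : Quaternion ℝ → Quaternion ℝ} (h : Induces Ω F f)
    (hFG : ∀ z ∈ sliceSet unitI Ω, F z = G z) : Induces Ω G f :=
  fun z hz J hJ => by rw [← hFG z hz]; exact h z hz J hJ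

section IsHoloStem

variable {E : Type*} [NormedAddCommGroup E] [NormedSpace ℂ E] [Star E]

lemma IsHoloStem.mono {D D' : Set ℂ} {A : ℂ → E} (h : IsHoloStem D A) (hD : D' ⊆ D) :
    IsHoloStem D' A :=
  ⟨h.1.mono hD, fun z hz => h.2 z (hD hz)⟩

end IsHoloStem

lemma IsHoloStem.smul {D : Set ℂ} {A : ℂ → ℂ} {H : ℂ → Fin 3 → ℂ} (hA : IsHoloStem D A)
    (hH : IsHoloStem D H) : IsHoloStem D fun z => A z • H z :=
  ⟨hA.1.smul hH.1, fun z hz => by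
    change A (star z) • H (star z) = _
    rw [hA.2 z hz, hH.2 z hz]; ext i; simp⟩

lemma IsHoloStem.mul {D : Set ℂ} {A B : ℂ → ℂ} (hA : IsHoloStem D A)
    (hB : IsHoloStem D B) : IsHoloStem D fun z => A z * B z :=
  ⟨hA.1.mul hB.1, fun z hz => by
    change A (star z) * B (star z) = _
    rw [hA.2 z hz, hB.2 z hz]; simp⟩

lemma IsHoloStem.dotProduct {D : Set ℂ} {A B : ℂ → Fin 3 → ℂ} (hA : IsHoloStem D A)
    (hB : IsHoloStem D B) : IsHoloStem D fun z => A z ⬝ᵥ B z := by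
  refine ⟨?_, fun z hz => ?_⟩
  · have h1 (i) : DifferentiableOn ℂ (fun z => A z i) D := differentiableOn_pi.1 hA.1 i
    have h2 (i) : DifferentiableOn ℂ (fun z => B z i) D := differentiableOn_pi.1 hB.1 i
    simp only [_root_.dotProduct, Fin.sum_univ_three]
    exact (((h1 0).mul (h2 0)).add ((h1 1).mul (h2 1))).add ((h1 2).mul (h2 2))
  · simp only [hA.2 z hz, hB.2 z hz]
    simp [_root_.dotProduct, Fin.sum_univ_three]

lemma isHolo_coe_add_ofVec {Ω : Set (Quaternion ℝ)} {A : ℂ → ℂ} {H : ℂ → Fin 3 → ℂ}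
    (hA : DifferentiableOn ℂ A (sliceSet unitI Ω)) (hH : DifferentiableOn ℂ H (sliceSet unitI Ω)) :
    IsHolo Ω fun z => (A z : Quaternion ℂ) + ofVec (H z) := by
  have h (i) := differentiableOn_pi.1 hH i
  exact ⟨by simpa using hA, by simpa using h 0, by simpa using h 1, by simpa using h 2⟩

lemma isStem_coe_add_ofVec {Ω : Set (Quaternion ℝ)} {A : ℂ → ℂ} {H : ℂ → Fin 3 → ℂ}
    (hA : IsHoloStem (sliceSet unitI Ω) A) (hH : IsHoloStem (sliceSet unitI Ω) H) :
    IsStem Ω fun z => (A z : Quaternion ℂ) + ofVec (H z) := by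
  intro z hz
  have h1 := hA.2 z hz
  have h2 := hH.2 z hz
  simp only [Complex.star_def] at h1 h2
  simp only [h1, h2, conjC_add, conjC_coe, conjC_ofVec, Complex.star_def]

lemma isHoloStem_zero {E : Type*} [NormedAddCommGroup E] [NormedSpace ℂ E] [StarAddMonoid E]
    (D : Set ℂ) : IsHoloStem D fun _ => (0 : E) :=
  ⟨differentiableOn_const _, fun _ _ => by simp⟩

lemma isHoloStem_const (D : Set ℂ) (r : ℝ) : IsHoloStem D fun _ => (r : ℂ) :=
  ⟨differentiableOn_const _, fun _ _ => by simp⟩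

lemma ofVec_zero : ofVec 0 = 0 := by ext <;> simp

lemma mem_SR_of_induces {Ω : Set (Quaternion ℝ)} {A : ℂ → ℂ} {H : ℂ → Fin 3 → ℂ}
    (hA : IsHoloStem (sliceSet unitI Ω) A) (hH : IsHoloStem (sliceSet unitI Ω) H)
    {f : Quaternion ℝ → Quaternion ℝ}
    (hf : Induces Ω (fun z => (A z : Quaternion ℂ) + ofVec (H z)) f) : f ∈ SR Ω :=
  ⟨_, isStem_coe_add_ofVec hA hH, isHolo_coe_add_ofVec hA.1 hH.1, hf⟩

lemma mem_SRReal_of_induces {Ω : Set (Quaternion ℝ)} (hΩ : AxiallySymmetric Ω) {A : ℂ → ℂ}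
    (hA : IsHoloStem (sliceSet unitI Ω) A)
    {f : Quaternion ℝ → Quaternion ℝ} (hf : Induces Ω (fun z => (A z : Quaternion ℂ)) f) :
    f ∈ SRReal Ω := by
  refine ⟨mem_SR_of_induces hA (isHoloStem_zero _) (hf.congr fun z _ => ?_), ?_⟩
  · rw [ofVec_zero, add_zero]
  · rintro I hI _ ⟨hq, z, rfl⟩
    rw [hf z ((slicePoint_mem_iff hΩ hI).1 hq) I hI, phi_coe]
    exact ⟨_, rfl⟩

/-- The slice function with scalar stem function `A`. -/
lemma exists_mem_SRReal {Ω : Set (Quaternion ℝ)} (hΩ : AxiallySymmetric Ω) {A : ℂ → ℂ}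
    (hA : IsHoloStem (sliceSet unitI Ω) A) :
    ∃ f ∈ SRReal Ω, Induces Ω (fun z => (A z : Quaternion ℂ)) f := by
  have h : Induces Ω (fun z => (A z : Quaternion ℂ)) (induced fun z => (A z : Quaternion ℂ)) := by
    apply induces_induced
    have := isStem_coe_add_ofVec hA (isHoloStem_zero _)
    simpa only [ofVec_zero, add_zero] using this
  exact ⟨_, mem_SRReal_of_induces hΩ hA h, h⟩

lemma mem_slicePlane {J q : Quaternion ℝ} (h : q ∈ slicePlane J) : ∃ a b : ℝ, q = a + b • J := by
  obtain ⟨z, rfl⟩ := h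
  exact ⟨z.re, z.im, by rw [slicePoint, Quaternion.mul_coe_eq_smul]⟩

lemma exists_scalar_stem {Ω : Set (Quaternion ℝ)} (hΩ : AxiallySymmetric Ω)
    {f : Quaternion ℝ → Quaternion ℝ} (hf : f ∈ SRReal Ω) :
    ∃ A : ℂ → ℂ, IsHoloStem (sliceSet unitI Ω) A ∧ Induces Ω (fun z => (A z : Quaternion ℂ)) f := by
  obtain ⟨⟨F, hF, hF', h⟩, hr⟩ := hf
  have key (z) (hz : z ∈ sliceSet unitI Ω) (J) (hJ : J ∈ imagUnits) :
      phi J (F z) ∈ slicePlane J := by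
    rw [← h z hz J hJ]
    exact hr J hJ _ ⟨(slicePoint_mem_iff hΩ hJ).2 hz, z, rfl⟩
  have key' (z) (hz : z ∈ sliceSet unitI Ω) (J) (hJ : J ∈ imagUnits) :
      phi (-J) (F z) ∈ slicePlane J := by
    have := key (star z) ((star_mem_iff hΩ).2 hz) J hJ
    rwa [Complex.star_def, hF z hz, phi_conjC] at this
  have main (z) (hz : z ∈ sliceSet unitI Ω) : F z = ((F z).re : Quaternion ℂ) := by
    -- The values at `±i` force both components of `F z` into `ℂ_i`, those at `±j` force them into
    -- `ℂ_j`; the intersection of the two planes is `ℝ`.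
    obtain ⟨a, b, h1⟩ := mem_slicePlane (key z hz _ unitI_mem)
    obtain ⟨a', b', h1'⟩ := mem_slicePlane (key' z hz _ unitI_mem)
    obtain ⟨c, d, h2⟩ := mem_slicePlane (key z hz _ unitJ_mem)
    obtain ⟨c', d', h2'⟩ := mem_slicePlane (key' z hz _ unitJ_mem)
    rw [phi] at h1 h1' h2 h2'
    have e1 := congrArg QuaternionAlgebra.imJ h1
    have e1' := congrArg QuaternionAlgebra.imJ h1'
    have e2 := congrArg QuaternionAlgebra.imK h1
    have e2' := congrArg QuaternionAlgebra.imK h1'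
    have e3 := congrArg QuaternionAlgebra.imI h2
    have e3' := congrArg QuaternionAlgebra.imI h2'
    have e4 := congrArg QuaternionAlgebra.imK h2
    have e4' := congrArg QuaternionAlgebra.imK h2'
    simp at e1 e1' e2 e2' e3 e3' e4 e4'
    ext <;> apply Complex.ext <;> simp <;> linarith
  refine ⟨fun z => (F z).re, ⟨hF'.1, fun z hz => ?_⟩, h.congr main⟩
  have e := congrArg QuaternionAlgebra.re (hF z hz)
  rwa [conjC_re] at e

lemma scalarPart_eq_zero {Ω : Set (Quaternion ℝ)} (hΩ : AxiallySymmetric Ω)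
    {f : Quaternion ℝ → Quaternion ℝ} {F : ℂ → Quaternion ℂ} (hf : Induces Ω F f)
    (h0 : ∀ z ∈ sliceSet unitI Ω, (F z).re = 0) {q : Quaternion ℝ} (hq : q ∈ Ω) :
    scalarPart f q = 0 := by
  have hz : (⟨q.re, ‖q.im‖⟩ : ℂ) ∈ sliceSet unitI Ω := (sliceCoord_mem_iff hΩ).2 hq
  rw [scalarPart, induced, stem_eq hf hz, h0 _ hz]
  have : ((0 : ℂ) : Quaternion ℂ) = 0 := by ext <;> simp
  rw [this, phi_zero]

lemma mem_SRVec_of_induces {Ω : Set (Quaternion ℝ)} (hΩ : AxiallySymmetric Ω) {H : ℂ → Fin 3 → ℂ}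
    (hH : IsHoloStem (sliceSet unitI Ω) H)
    {f : Quaternion ℝ → Quaternion ℝ} (hf : Induces Ω (fun z => ofVec (H z)) f) : f ∈ SRVec Ω := by
  refine ⟨mem_SR_of_induces (isHoloStem_zero _) hH (hf.congr fun z _ => ?_), fun q hq => ?_⟩
  · ext <;> simp
  · rw [vecPart, scalarPart_eq_zero hΩ hf (fun _ _ => rfl) hq, sub_zero]

lemma induces_vec {Ω : Set (Quaternion ℝ)} {H : ℂ → Fin 3 → ℂ}
    (hH : IsHoloStem (sliceSet unitI Ω) H) :
    Induces Ω (fun z => ofVec (H z)) (induced fun z => ofVec (H z)) := by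
  apply induces_induced
  intro z hz
  have := hH.2 z hz
  rw [Complex.star_def] at this
  simp only [this, conjC_ofVec]

lemma exists_vec_stem {Ω : Set (Quaternion ℝ)} (hΩ : AxiallySymmetric Ω)
    {f : Quaternion ℝ → Quaternion ℝ} (hf : f ∈ SRVec Ω) :
    ∃ H : ℂ → Fin 3 → ℂ, IsHoloStem (sliceSet unitI Ω) H ∧ Induces Ω (fun z => ofVec (H z)) f := by
  obtain ⟨⟨F, hF, hF', h⟩, hv⟩ := hf
  have hs : ∀ q ∈ Ω, scalarPart f q = 0 := fun q hq => by
    have := hv q hq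
    rw [vecPart] at this
    exact (sub_eq_self.1 this.symm)
  have hst : Induces Ω (fun z => ((F z).re : Quaternion ℂ)) (scalarPart f) := by
    have h1 : Induces Ω (fun z => ((stem f z).re : Quaternion ℂ)) (scalarPart f) := by
      apply induces_induced
      intro z hz
      have hz' : starRingEnd ℂ z ∈ sliceSet unitI Ω := (star_mem_iff hΩ).2 hz
      simp only [stem_eq h hz, stem_eq h hz', hF z hz, conjC_coe]
      congr 1
    exact h1.congr fun z hz => by rw [stem_eq h hz]
  have h0 (z) (hz : z ∈ sliceSet unitI Ω) : (F z).re = 0 := by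
    have := (hst.zero_iff hΩ).1 hs z hz
    simpa using congrArg QuaternionAlgebra.re this
  refine ⟨fun z => toVec (F z), ⟨differentiableOn_pi.2 fun i => ?_, fun z hz => ?_⟩,
    h.congr fun z hz => (ofVec_toVec (h0 z hz)).symm⟩
  · fin_cases i
    exacts [hF'.2.1, hF'.2.2.1, hF'.2.2.2]
  · have e := ofVec_toVec (h0 z hz)
    have e2 := hF z hz
    rw [← e, conjC_ofVec] at e2
    change toVec (F (starRingEnd ℂ z)) = _
    rw [e2, toVec_ofVec]

/-! ### The identity theorem on axially symmetric domains -/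

section Identity

variable {E : Type*} [NormedAddCommGroup E] [NormedSpace ℂ E] [StarAddMonoid E]

/-- Conjugation carries a zero germ at `z` to one at `z̄`, so the vanishing of germs can be tested
in the closed upper half plane. -/
lemma IsHoloStem.eventually_zero_fold {W : Set (Quaternion ℝ)} (hW : IsAxOpen W) {A : ℂ → E}
    (hA : IsHoloStem (sliceSet unitI W) A) {z : ℂ} (hz : z ∈ sliceSet unitI W)
    (h : ∀ᶠ y in 𝓝 z, A y = 0) : ∀ᶠ y in 𝓝 (fold z), A y = 0 := by
  rcases fold_eq_or z with e | e <;> rw [e]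
  · exact h
  have hD : ∀ᶠ y in 𝓝 z, y ∈ sliceSet unitI W := (isOpen_sliceSet hW.1 unitI).mem_nhds hz
  have hc : Tendsto (fun y : ℂ => star y) (𝓝 (star z)) (𝓝 z) := by
    have : Continuous fun y : ℂ => star y := continuous_star
    simpa using this.tendsto (star z)
  filter_upwards [hc.eventually (h.and hD)] with y hy
  have := hA.2 _ hy.2
  rwa [star_star, hy.1, star_zero] at this

/-- A holomorphic stem function that is not identically zero on an axially symmetric domain has
isolated zeros. -/
lemma IsHoloStem.eventually_ne_zero [CompleteSpace E] {W : Set (Quaternion ℝ)} (hW : IsAxDomain W)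
    {A : ℂ → E} (hA : IsHoloStem (sliceSet unitI W) A) (hne : ∃ z ∈ sliceSet unitI W, A z ≠ 0) {z : ℂ}
    (hz : z ∈ sliceSet unitI W) : ∀ᶠ y in 𝓝[≠] z, A y ≠ 0 := by
  have hD := isOpen_sliceSet hW.1.1 unitI
  have han {y} (hy : y ∈ sliceSet unitI W) : AnalyticAt ℂ A y := hA.1.analyticAt (hD.mem_nhds hy)
  -- The slice may be disconnected, so the clopen argument runs on `W`: the open sets `u` and `v`
  -- are pulled back along `sliceCoord`.
  let u : Set ℂ := {y | ∀ᶠ x in 𝓝 y, A x = 0}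
  let v : Set ℂ := {y | y ∈ sliceSet unitI W ∧ ∀ᶠ x in 𝓝[≠] y, A x ≠ 0}
  have hu : IsOpen u := isOpen_setOfPred_eventually_nhds
  have hv : IsOpen v := by
    rw [isOpen_iff_mem_nhds]
    rintro y ⟨hy, hy'⟩
    have h1 := eventually_nhdsWithin_iff.1 hy'
    filter_upwards [h1, hD.mem_nhds hy] with x hx hxD
    refine ⟨hxD, ?_⟩
    by_cases hxy : x = y
    · rwa [hxy]
    · refine (han hxD).eventually_eq_zero_or_eventually_ne_zero.resolve_left fun h => ?_
      exact hx hxy h.self_of_nhds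
  have hdisj {y} (h1 : y ∈ u) (h2 : y ∈ v) : False := by
    obtain ⟨x, hx⟩ := (h2.2.and (h1.filter_mono nhdsWithin_le_nhds)).exists
    exact hx.1 hx.2
  refine (han hz).eventually_eq_zero_or_eventually_ne_zero.resolve_left fun h0 => ?_
  obtain ⟨y, hy, hy0⟩ := hne
  have hyf : A (fold y) ≠ 0 := by
    rcases fold_eq_or y with e | e <;> rw [e]
    · exact hy0
    · rw [hA.2 y hy]; exact star_ne_zero.2 hy0
  have hyf' : fold y ∈ v := by
    have hm := (fold_mem_iff hW.1.2).2 hy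
    refine ⟨hm, (han hm).eventually_eq_zero_or_eventually_ne_zero.resolve_left fun h => ?_⟩
    exact hyf h.self_of_nhds
  have hpre := hW.2.isPreconnected (sliceCoord ⁻¹' u) (sliceCoord ⁻¹' v)
    (hu.preimage continuous_sliceCoord) (hv.preimage continuous_sliceCoord) (fun q hq => by
      have hm := (sliceCoord_mem_iff hW.1.2).2 hq
      rcases (han hm).eventually_eq_zero_or_eventually_ne_zero with h | h
      exacts [Or.inl h, Or.inr ⟨hm, h⟩])
    ⟨slicePoint unitI z, hz, by
      rw [Set.mem_preimage, sliceCoord_slicePoint unitI_mem]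
      exact hA.eventually_zero_fold hW.1 hz h0⟩
    ⟨slicePoint unitI y, hy, by rwa [Set.mem_preimage, sliceCoord_slicePoint unitI_mem]⟩
  obtain ⟨q, -, h1, h2⟩ := hpre
  exact hdisj h1 h2

lemma IsHoloStem.zero_iff_of_subset [CompleteSpace E] {W V : Set (Quaternion ℝ)} (hW : IsAxDomain W)
    (hV : IsAxOpen V) (hne : V.Nonempty) (hVW : V ⊆ W) {A : ℂ → E}
    (hA : IsHoloStem (sliceSet unitI W) A) :
    (∀ z ∈ sliceSet unitI V, A z = 0) ↔ ∀ z ∈ sliceSet unitI W, A z = 0 := by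
  refine ⟨fun h => ?_, fun h z hz => h z (hVW hz)⟩
  by_contra! hcon
  obtain ⟨z, hz⟩ := sliceSet_nonempty hV.2 hne
  have h1 := hA.eventually_ne_zero hW hcon (hVW hz)
  have h2 : ∀ᶠ y in 𝓝[≠] z, A y = 0 := by
    filter_upwards [mem_nhdsWithin_of_mem_nhds ((isOpen_sliceSet hV.1 unitI).mem_nhds hz)]
      with y hy using h y hy
  obtain ⟨x, hx⟩ := (h1.and h2).exists
  exact hx.1 hx.2

end Identity

lemma SRVec.mono {U V : Set (Quaternion ℝ)} (hU : AxiallySymmetric U) (hV : AxiallySymmetric V)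
    (hVU : V ⊆ U) {f : Quaternion ℝ → Quaternion ℝ} (hf : f ∈ SRVec U) : f ∈ SRVec V := by
  obtain ⟨H, hH, h⟩ := exists_vec_stem hU hf
  exact mem_SRVec_of_induces hV (hH.mono fun z hz => hVU hz) (h.mono hVU)

lemma ofVec_eq_zero {v : Fin 3 → ℂ} : ofVec v = 0 ↔ v = 0 := by
  refine ⟨fun h => ?_, fun h => by rw [h, ofVec_zero]⟩
  rw [← toVec_ofVec v, h]
  funext i; fin_cases i <;> rfl

lemma coe_eq_zero {c : ℂ} : (c : Quaternion ℂ) = 0 ↔ c = 0 := by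
  refine ⟨fun h => ?_, fun h => by rw [h]; ext <;> simp⟩
  simpa using congrArg QuaternionAlgebra.re h

lemma SRVec.zero_iff_of_subset {W V : Set (Quaternion ℝ)} (hW : IsAxDomain W)
    (hV : IsAxOpen V) (hne : V.Nonempty) (hVW : V ⊆ W) {f : Quaternion ℝ → Quaternion ℝ}
    (hf : f ∈ SRVec W) : (∀ q ∈ V, f q = 0) ↔ ∀ q ∈ W, f q = 0 := by
  obtain ⟨H, hH, h⟩ := exists_vec_stem hW.1.2 hf
  rw [h.zero_iff hW.1.2, (h.mono hVW).zero_iff hV.2]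
  simp only [ofVec_eq_zero]
  exact hH.zero_iff_of_subset hW hV hne hVW

/-! ### Linear dependence in terms of stem functions -/

lemma induces_mul_vec {W : Set (Quaternion ℝ)} {A B : ℂ → ℂ} {F H : ℂ → Fin 3 → ℂ}
    {a b f h : Quaternion ℝ → Quaternion ℝ}
    (ha : Induces W (fun z => (A z : Quaternion ℂ)) a)
    (hb : Induces W (fun z => (B z : Quaternion ℂ)) b)
    (hf : Induces W (fun z => ofVec (F z)) f) (hh : Induces W (fun z => ofVec (H z)) h) :
    Induces W (fun z => ofVec (A z • F z + B z • H z)) (fun q => a q * f q + b q * h q) := by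
  intro z hz J hJ
  have e : ofVec (A z • F z + B z • H z)
      = (A z : Quaternion ℂ) * ofVec (F z) + (B z : Quaternion ℂ) * ofVec (H z) := by
    ext <;> simp
  simp only [ha z hz J hJ, hb z hz J hJ, hf z hz J hJ, hh z hz J hJ, e, phi_add, phi_coe_mul hJ]

lemma linDep_iff {W : Set (Quaternion ℝ)} (hW : AxiallySymmetric W) {F H : ℂ → Fin 3 → ℂ}
    {f h : Quaternion ℝ → Quaternion ℝ}
    (hf : Induces W (fun z => ofVec (F z)) f) (hh : Induces W (fun z => ofVec (H z)) h) :
    LinDep W f h ↔ ∃ A B : ℂ → ℂ, IsHoloStem (sliceSet unitI W) A ∧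
      IsHoloStem (sliceSet unitI W) B ∧ (∃ z ∈ sliceSet unitI W, A z ≠ 0 ∨ B z ≠ 0) ∧
      ∀ z ∈ sliceSet unitI W, A z • F z + B z • H z = 0 := by
  have key {a b : Quaternion ℝ → Quaternion ℝ} {A B : ℂ → ℂ}
      (ha : Induces W (fun z => (A z : Quaternion ℂ)) a)
      (hb : Induces W (fun z => (B z : Quaternion ℂ)) b) :
      (((∃ q ∈ W, a q ≠ 0) ∨ ∃ q ∈ W, b q ≠ 0) ∧ ∀ q ∈ W, a q * f q + b q * h q = 0) ↔
      ((∃ z ∈ sliceSet unitI W, A z ≠ 0 ∨ B z ≠ 0) ∧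
      ∀ z ∈ sliceSet unitI W, A z • F z + B z • H z = 0) := by
    have h1 := ha.zero_iff hW
    have h2 := hb.zero_iff hW
    have h3 := (induces_mul_vec ha hb hf hh).zero_iff hW
    simp only [ofVec_eq_zero, coe_eq_zero] at h1 h2 h3
    rw [h3]
    refine and_congr_left fun _ => ?_
    have h1' := not_congr h1
    have h2' := not_congr h2
    push Not at h1' h2'
    rw [h1', h2']
    constructor
    · rintro (⟨z, hz, h⟩ | ⟨z, hz, h⟩)
      exacts [⟨z, hz, Or.inl h⟩, ⟨z, hz, Or.inr h⟩]
    · rintro ⟨z, hz, h | h⟩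
      exacts [Or.inl ⟨z, hz, h⟩, Or.inr ⟨z, hz, h⟩]
  constructor
  · rintro ⟨a, ha, b, hb, h⟩
    obtain ⟨A, hA, ha'⟩ := exists_scalar_stem hW ha
    obtain ⟨B, hB, hb'⟩ := exists_scalar_stem hW hb
    exact ⟨A, B, hA, hB, (key ha' hb').1 h⟩
  · rintro ⟨A, B, hA, hB, h⟩
    obtain ⟨a, ha, ha'⟩ := exists_mem_SRReal hW hA
    obtain ⟨b, hb, hb'⟩ := exists_mem_SRReal hW hB
    exact ⟨a, ha, b, hb, (key ha' hb').2 h⟩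

/-- The only issue is that the coefficients might both vanish on `V`; by the identity theorem they
would then vanish on the connected set `W`. -/
lemma LinDep.mono {W V : Set (Quaternion ℝ)} (hW : IsAxDomain W) (hV : IsAxOpen V)
    (hne : V.Nonempty) (hVW : V ⊆ W) {f h : Quaternion ℝ → Quaternion ℝ} (hf : f ∈ SRVec W)
    (hh : h ∈ SRVec W) (hd : LinDep W f h) : LinDep V f h := by
  obtain ⟨F, -, hF⟩ := exists_vec_stem hW.1.2 hf
  obtain ⟨H, -, hH⟩ := exists_vec_stem hW.1.2 hh
  obtain ⟨A, B, hA, hB, ⟨z, hz, hne'⟩, h0⟩ := (linDep_iff hW.1.2 hF hH).1 hd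
  have hsub : sliceSet unitI V ⊆ sliceSet unitI W := fun z hz => hVW hz
  refine (linDep_iff hV.2 (hF.mono hVW) (hH.mono hVW)).2
    ⟨A, B, hA.mono hsub, hB.mono hsub, ?_, fun z hz => h0 z (hsub hz)⟩
  by_contra! hcon
  have hA0 := (hA.zero_iff_of_subset hW hV hne hVW).1 fun z hz => (hcon z hz).1
  have hB0 := (hB.zero_iff_of_subset hW hV hne hVW).1 fun z hz => (hcon z hz).2
  rcases hne' with h | h
  exacts [h (hA0 z hz), h (hB0 z hz)]

lemma exists_axDomain_subset {U : Set (Quaternion ℝ)} (hU : IsAxOpen U) {p : Quaternion ℝ}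
    (hp : p ∈ U) : ∃ V, IsAxDomain V ∧ p ∈ V ∧ V ⊆ U := by
  obtain ⟨r, hr, h⟩ := exists_axBall_subset hU ((sliceCoord_mem_iff hU.2).2 hp)
  obtain ⟨J, hJ, e⟩ := exists_slicePoint_eq p
  refine ⟨_, isAxDomain_axBall _ hr, ?_, h⟩
  have := slicePoint_self_mem_axBall hJ (sliceCoord p) hr
  rwa [← e] at this

lemma IsAxOpen.inter {U V : Set (Quaternion ℝ)} (hU : IsAxOpen U) (hV : IsAxOpen V) :
    IsAxOpen (U ∩ V) :=
  ⟨hU.1.inter hV.1, fun I hI z hz J hJ => ⟨hU.2 I hI z hz.1 J hJ, hV.2 I hI z hz.2 J hJ⟩⟩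

/-- The domain witnessing an equivalence can be taken inside any prescribed axially symmetric
neighbourhood: dependence and the vanishing condition both pass to subdomains. -/
lemma EquivAt.exists_subset {p : Quaternion ℝ} {U U' V : Set (Quaternion ℝ)}
    {f h : Quaternion ℝ → Quaternion ℝ} (he : EquivAt p U f U' h) (hU : IsAxOpen U)
    (hU' : IsAxOpen U') (hf : f ∈ SRVec U) (hh : h ∈ SRVec U') (hV : IsAxOpen V) (hp : p ∈ V) :
    ∃ W, IsAxDomain W ∧ p ∈ W ∧ W ⊆ V ∧ W ⊆ U ∩ U' ∧ LinDep W f h ∧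
      ((∀ q ∈ W, f q = 0) ↔ ∀ q ∈ W, h q = 0) := by
  obtain ⟨W, hW, hpW, hWU, hd, hz⟩ := he
  obtain ⟨W', hW', hpW', hsub⟩ := exists_axDomain_subset (hW.1.inter hV) ⟨hpW, hp⟩
  have hf' := SRVec.mono hU.2 hW.1.2 (fun q hq => (hWU hq).1) hf
  have hh' := SRVec.mono hU'.2 hW.1.2 (fun q hq => (hWU hq).2) hh
  have hs : W' ⊆ W := fun q hq => (hsub hq).1
  refine ⟨W', hW', hpW', fun q hq => (hsub hq).2, hs.trans hWU,
    LinDep.mono hW hW'.1 ⟨p, hpW'⟩ hs hf' hh' hd, ?_⟩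
  rw [SRVec.zero_iff_of_subset hW hW'.1 ⟨p, hpW'⟩ hs hf',
    SRVec.zero_iff_of_subset hW hW'.1 ⟨p, hpW'⟩ hs hh', hz]

lemma EquivAt.refl {p : Quaternion ℝ} {U : Set (Quaternion ℝ)} {f : Quaternion ℝ → Quaternion ℝ}
    (h : IsLocalVec p (U, f)) : EquivAt p U f U f := by
  obtain ⟨V, hV, hpV, hVU⟩ := exists_axDomain_subset h.1 h.2.1
  obtain ⟨H, hH, hHf⟩ := exists_vec_stem h.1.2 h.2.2
  have hHf := hHf.mono hVU
  refine ⟨V, hV, hpV, fun q hq => ⟨hVU hq, hVU hq⟩, ?_, Iff.rfl⟩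
  obtain ⟨z, hz⟩ := sliceSet_nonempty hV.1.2 hV.2.nonempty
  refine (linDep_iff hV.1.2 hHf hHf).2 ⟨_, _, isHoloStem_const _ 1, isHoloStem_const _ (-1),
    ⟨z, hz, Or.inl (by simp)⟩, fun z _ => by simp⟩

/-- On a domain where both functions vanish they are equivalent. -/
lemma equivAt_of_zero {p : Quaternion ℝ} {U U' V : Set (Quaternion ℝ)}
    {f h : Quaternion ℝ → Quaternion ℝ} (hV : IsAxDomain V) (hp : p ∈ V) (hVU : V ⊆ U ∩ U')
    (hf : ∀ q ∈ V, f q = 0) (hh : ∀ q ∈ V, h q = 0) : EquivAt p U f U' h := by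
  have h0 {f : Quaternion ℝ → Quaternion ℝ} (hf : ∀ q ∈ V, f q = 0) :
      Induces V (fun _ => ofVec 0) f := fun z hz J hJ => by
    rw [ofVec_zero, phi_zero]; exact hf _ ((slicePoint_mem_iff hV.1.2 hJ).2 hz)
  obtain ⟨z, hz⟩ := sliceSet_nonempty hV.1.2 hV.2.nonempty
  refine ⟨V, hV, hp, hVU, (linDep_iff hV.1.2 (h0 hf) (h0 hh)).2 ⟨_, _, isHoloStem_const _ 1,
    isHoloStem_const _ 1, ⟨z, hz, Or.inl (by simp)⟩, fun z _ => by simp⟩, iff_of_true hf hh⟩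

/-! ### Representatives of vectorial classes -/

namespace VectorialClass

variable {Ω : Set (Quaternion ℝ)} (ω : VectorialClass Ω)

lemma isLocalVec_of_mem {p : Quaternion ℝ} (hp : p ∈ Ω) {V : Set (Quaternion ℝ)}
    {f : Quaternion ℝ → Quaternion ℝ} (h : (V, f) ∈ ω.cls p) : IsLocalVec p (V, f) := by
  obtain ⟨U, h', -, e⟩ := ω.isClass p hp
  rw [e] at h
  exact h.1

lemma mem_of_subset {p : Quaternion ℝ} (hp : p ∈ Ω) {V V' : Set (Quaternion ℝ)}
    {f : Quaternion ℝ → Quaternion ℝ} (h : (V, f) ∈ ω.cls p) (hV' : IsAxOpen V') (hpV : p ∈ V')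
    (hVV : V' ⊆ V) : (V', f) ∈ ω.cls p := by
  have hl := ω.isLocalVec_of_mem hp h
  obtain ⟨U, h', hl', e⟩ := ω.isClass p hp
  rw [e] at h ⊢
  refine ⟨⟨hV', hpV, SRVec.mono hl.1.2 hV'.2 hVV hl.2.2⟩, ?_⟩
  obtain ⟨W, hW, hpW, hWV, hWU, hd, hz⟩ := h.2.exists_subset hl'.1 hl.1 hl'.2.2 hl.2.2 hV' hpV
  exact ⟨W, hW, hpW, fun q hq => ⟨(hWU hq).1, hWV hq⟩, hd, hz⟩

lemma exists_mem_cls {p : Quaternion ℝ} (hp : p ∈ Ω) : ∃ V f, (V, f) ∈ ω.cls p := by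
  obtain ⟨U, f, hl, e⟩ := ω.isClass p hp
  exact ⟨U, f, by rw [e]; exact ⟨hl, EquivAt.refl hl⟩⟩

lemma exists_domain_mem_cls {p : Quaternion ℝ} (hΩ : IsAxOpen Ω) (hp : p ∈ Ω)
    {V : Set (Quaternion ℝ)} {f : Quaternion ℝ → Quaternion ℝ} (h : (V, f) ∈ ω.cls p) :
    ∃ V', IsAxDomain V' ∧ p ∈ V' ∧ V' ⊆ V ∧ V' ⊆ Ω ∧ (V', f) ∈ ω.cls p := by
  have hl := ω.isLocalVec_of_mem hp h
  obtain ⟨V', hV', hpV', hsub⟩ := exists_axDomain_subset (hl.1.inter hΩ) ⟨hl.2.1, hp⟩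
  exact ⟨V', hV', hpV', fun q hq => (hsub hq).1, fun q hq => (hsub hq).2,
    ω.mem_of_subset hp h hV'.1 hpV' fun q hq => (hsub hq).1⟩

/-- The class is null at `p`. -/
def NullAt (p : Quaternion ℝ) : Prop :=
  ∃ V f, IsAxDomain V ∧ V ⊆ Ω ∧ (V, f) ∈ ω.cls p ∧ ∀ q ∈ V, f q = 0

lemma NullAt.cls_eq {ω : VectorialClass Ω} {p : Quaternion ℝ} (hp : p ∈ Ω) (h : ω.NullAt p) :
    ω.cls p = vecClass p Set.univ fun _ => 0 := by
  obtain ⟨V, f, hV, hVΩ, hm, hf0⟩ := h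
  have hl := ω.isLocalVec_of_mem hp hm
  obtain ⟨U, g, hg, e⟩ := ω.isClass p hp
  have hm' := hm
  rw [e] at hm'
  obtain ⟨W, hW, hpW, hWV, hWU, -, hz⟩ := hm'.2.exists_subset hg.1 hl.1 hg.2.2 hl.2.2 hl.1 hl.2.1
  have hg0 : ∀ q ∈ W, g q = 0 := hz.2 fun q hq => hf0 q (hWV hq)
  rw [e]
  ext ⟨V₁, f₁⟩
  constructor
  · rintro ⟨h1, h2⟩
    refine ⟨h1, ?_⟩
    obtain ⟨W₁, hW₁, hp₁, hWW, hWU₁, -, hz₁⟩ := h2.exists_subset hg.1 h1.1 hg.2.2 h1.2.2 hW.1 hpW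
    exact equivAt_of_zero hW₁ hp₁ (fun q hq => ⟨trivial, (hWU₁ hq).2⟩) (fun _ _ => rfl)
      (hz₁.1 fun q hq => hg0 q (hWW hq))
  · rintro ⟨h1, h2⟩
    refine ⟨h1, ?_⟩
    obtain ⟨W₁, hW₁, hp₁, hWU₁, -, hz₁⟩ := h2
    obtain ⟨W₂, hW₂, hp₂, hs⟩ := exists_axDomain_subset (hW.1.inter hW₁.1) ⟨hpW, hp₁⟩
    exact equivAt_of_zero hW₂ hp₂ (fun q hq => ⟨(hWU (hs hq).1).1, (hWU₁ (hs hq).2).2⟩)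
      (fun q hq => hg0 q (hs hq).1) (fun q hq => hz₁.1 (fun _ _ => rfl) q (hs hq).2)

/-- By compatibility, nullity at `q` means that `f` vanishes on some open part of `V`, and the
identity theorem extends this to `V`. The right-hand side does not involve `q`, so nullity is
locally constant. -/
lemma NullAt.of_mem {ω : VectorialClass Ω} {p q : Quaternion ℝ} (hΩ : IsAxOpen Ω) (hp : p ∈ Ω)
    {V : Set (Quaternion ℝ)} {f : Quaternion ℝ → Quaternion ℝ} (hV : IsAxDomain V) (hVΩ : V ⊆ Ω)
    (hm : (V, f) ∈ ω.cls p) (hq : q ∈ V) : ω.NullAt q ↔ ∀ x ∈ V, f x = 0 := by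
  have hl := ω.isLocalVec_of_mem hp hm
  constructor
  · rintro ⟨V', f', hV', hVΩ', hm', h0⟩
    have hl' := ω.isLocalVec_of_mem (hVΩ hq) hm'
    obtain ⟨W, hW, -, hWV, -, hz⟩ :=
      ω.compat p hp q (hVΩ hq) V f V' f' hV hV' hVΩ hVΩ' hm hm' q ⟨hq, hl'.2.1⟩
    exact (SRVec.zero_iff_of_subset hV hW.1 hW.2.nonempty (fun x hx => (hWV hx).1) hl.2.2).1
      (hz.2 fun x hx => h0 x (hWV hx).2)
  · intro h0
    obtain ⟨V₁, f₁, hm₁⟩ := ω.exists_mem_cls (hVΩ hq)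
    obtain ⟨V', hV', hqV', -, hVΩ', hm'⟩ := ω.exists_domain_mem_cls hΩ (hVΩ hq) hm₁
    obtain ⟨W, hW, hqW, hWV, -, hz⟩ :=
      ω.compat p hp q (hVΩ hq) V f V' f₁ hV hV' hVΩ hVΩ' hm hm' q ⟨hq, hqV'⟩
    exact ⟨W, f₁, hW, fun x hx => hVΩ (hWV hx).1,
      ω.mem_of_subset (hVΩ hq) hm' hW.1 hqW fun x hx => (hWV hx).2,
      hz.1 fun x hx => h0 x (hWV hx).1⟩

/-- A vectorial class on a domain that is null at one point is null. -/
lemma not_nullAt {ω : VectorialClass Ω} (hΩ : IsAxDomain Ω) (hω : ¬ ω.IsNull) {p : Quaternion ℝ}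
    (hp : p ∈ Ω) : ¬ ω.NullAt p := by
  intro hnull
  obtain ⟨q, hq, hqn⟩ : ∃ q ∈ Ω, ¬ ω.NullAt q := by
    by_contra! h
    exact hω fun q hq => (h q hq).cls_eq hq
  have key {x} (hx : x ∈ Ω) : ∃ V, IsOpen V ∧ x ∈ V ∧ V ⊆ Ω ∧
      ∀ y ∈ V, (ω.NullAt y ↔ ω.NullAt x) := by
    obtain ⟨V₁, f₁, hm₁⟩ := ω.exists_mem_cls hx
    obtain ⟨V, hV, hxV, -, hVΩ, hm⟩ := ω.exists_domain_mem_cls hΩ.1 hx hm₁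
    refine ⟨V, hV.1.1, hxV, hVΩ, fun y hy => ?_⟩
    rw [NullAt.of_mem hΩ.1 hx hV hVΩ hm hy, NullAt.of_mem hΩ.1 hx hV hVΩ hm hxV]
  -- Used for `id` and for `Not`: the null points and the other points form two open sets covering
  -- `Ω`.
  have hopen (P : Prop → Prop) : IsOpen {x | x ∈ Ω ∧ P (ω.NullAt x)} := by
    rw [isOpen_iff_mem_nhds]
    rintro x ⟨hx, hPx⟩
    obtain ⟨V, hV, hxV, hVΩ, h⟩ := key hx
    filter_upwards [hV.mem_nhds hxV] with y hy
    exact ⟨hVΩ hy, by rwa [h y hy]⟩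
  obtain ⟨x, -, h1, h2⟩ := hΩ.2.isPreconnected _ _ (hopen id) (hopen Not)
    (fun x hx => (em (ω.NullAt x)).imp (fun h => ⟨hx, h⟩) fun h => ⟨hx, h⟩)
    ⟨p, hp, hp, hnull⟩ ⟨q, hq, hq, hqn⟩
  exact h2.2 h1.2

lemma eventually_ne_zero_of_mem {ω : VectorialClass Ω} (hΩ : IsAxDomain Ω) (hω : ¬ ω.IsNull)
    {z : ℂ} (hz : z ∈ sliceSet unitI Ω) {V : Set (Quaternion ℝ)}
    {f : Quaternion ℝ → Quaternion ℝ} (hm : (V, f) ∈ ω.cls (slicePoint unitI z))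
    {H : ℂ → Fin 3 → ℂ} (hH : IsHoloStem (sliceSet unitI V) H)
    (hHf : Induces V (fun z => ofVec (H z)) f) : ∀ᶠ y in 𝓝[≠] z, H y ≠ 0 := by
  obtain ⟨V', hV', hpV', hVV, hVΩ, hm'⟩ := ω.exists_domain_mem_cls hΩ.1 hz hm
  refine (hH.mono fun z hz => hVV hz).eventually_ne_zero hV' ?_ hpV'
  by_contra! h
  have := ((hHf.mono hVV).zero_iff hV'.1.2).2 fun z hz => by rw [h z hz, ofVec_zero]
  exact not_nullAt hΩ hω hz ⟨V', f, hV', hVΩ, hm', this⟩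

end VectorialClass

/-! ### Holomorphic branches on simply connected open sets -/

/-- Simple connectedness gives a continuous logarithm. Near `z` it moves by less than `π`, so it is
`L z` plus the principal logarithm of `G y / G z`, which is holomorphic. -/
lemma exists_log {C : Set ℂ} (hC : IsOpen C) (hs : IsSimplyConnected C) {G : ℂ → ℂ}
    (hG : DifferentiableOn ℂ G C) (h0 : ∀ z ∈ C, G z ≠ 0) :
    ∃ L : ℂ → ℂ, DifferentiableOn ℂ L C ∧ ∀ z ∈ C, Complex.exp (L z) = G z := by
  obtain ⟨L, hL, hLG⟩ := Complex.exists_continuousOn_eqOn_exp_comp hs hC hG.continuousOn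
    (by rintro ⟨z, hz, h⟩; exact h0 z hz h)
  refine ⟨L, fun z hz => DifferentiableAt.differentiableWithinAt ?_, hLG⟩
  have hc : ContinuousAt L z := hL.continuousAt (hC.mem_nhds hz)
  have hsmall : ∀ᶠ y in 𝓝 z, ‖L y - L z‖ < Real.pi := by
    have h1 : ContinuousAt (fun y => ‖L y - L z‖) z := (hc.sub continuousAt_const).norm
    exact h1.eventually_lt continuousAt_const (by simp [Real.pi_pos])
  have heq : L =ᶠ[𝓝 z] fun y => L z + Complex.log (G y / G z) := by
    filter_upwards [hsmall, hC.mem_nhds hz] with y hy hyC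
    have h1 := (Complex.abs_im_le_norm (L y - L z)).trans_lt hy
    rw [← hLG hyC, ← hLG hz, Function.comp_apply, Function.comp_apply, ← Complex.exp_sub,
      Complex.log_exp (abs_lt.1 h1).1 (abs_lt.1 h1).2.le]
    ring
  refine DifferentiableAt.congr_of_eventuallyEq ?_ heq
  refine (DifferentiableAt.clog ((hG.differentiableAt (hC.mem_nhds hz)).div_const _) ?_).const_add _
  rw [div_self (h0 z hz)]
  exact Complex.one_mem_slitPlane

/-- The complex quadric `v ⬝ v = 1` in `ℂ³`. -/
abbrev Quadric : Type := {v : Fin 3 → ℂ // v ⬝ᵥ v = 1}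

/-- The sign group acts freely because `0` is not on the quadric; being finite, it acts properly
discontinuously, and the quotient map is a covering. -/
instance : MulAction ℤˣ Quadric where
  smul e v := ⟨((e : ℤ) : ℂ) • v.1, by
    rcases Int.units_eq_one_or e with rfl | rfl <;> simp [v.2]⟩
  one_smul v := Subtype.ext (show ((((1 : ℤˣ) : ℤ)) : ℂ) • v.1 = v.1 by simp)
  mul_smul e e' v := Subtype.ext (show ((((e * e' : ℤˣ) : ℤ)) : ℂ) • v.1
    = ((e : ℤ) : ℂ) • ((e' : ℤ) : ℂ) • v.1 by simp [mul_smul])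

lemma Quadric.coe_smul (e : ℤˣ) (v : Quadric) : (e • v).1 = ((e : ℤ) : ℂ) • v.1 := rfl

instance : ContinuousConstSMul ℤˣ Quadric where
  continuous_const_smul e := by
    refine Continuous.subtype_mk (f := fun v : Quadric => ((e : ℤ) : ℂ) • v.1) ?_ _
    exact (continuous_subtype_val (p := fun v : Fin 3 → ℂ => v ⬝ᵥ v = 1)).const_smul
      ((e : ℤ) : ℂ)

lemma Quadric.ne_zero (v : Quadric) : v.1 ≠ 0 := by
  intro h
  have := v.2
  simp [h] at this

instance : IsCancelSMul ℤˣ Quadric where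
  right_cancel' e e' v h := by
    have h1 := congrArg Subtype.val h
    rw [Quadric.coe_smul, Quadric.coe_smul] at h1
    have h2 := smul_left_injective ℂ v.ne_zero h1
    exact Units.ext (by exact_mod_cast h2)

instance : LocallyCompactSpace Quadric := by
  have : IsClosed {v : Fin 3 → ℂ | v ⬝ᵥ v = 1} := by
    refine isClosed_eq ?_ continuous_const
    simp only [dotProduct, Fin.sum_univ_three]
    fun_prop
  exact this.isClosedEmbedding_subtypeVal.locallyCompactSpace

/-- Unit vector fields on a simply connected open set that are given locally and up to sign come
from a global one. -/
lemma exists_global_unit {D : Set ℂ} (hD : IsOpen D) (hs : IsSimplyConnected D)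
    (s : ℂ → ℂ → Fin 3 → ℂ)
    (hdiff : ∀ z ∈ D, ∀ᶠ y in 𝓝 z, DifferentiableAt ℂ (s z) y ∧ s z y ⬝ᵥ s z y = 1)
    (hsign : ∀ z ∈ D, ∀ᶠ y in 𝓝 z, s y y = s z y ∨ s y y = -s z y) :
    ∃ v : ℂ → Fin 3 → ℂ, DifferentiableOn ℂ v D ∧
      ∀ z ∈ D, v z ⬝ᵥ v z = 1 ∧ ∀ᶠ y in 𝓝 z, v y = s z y ∨ v y = -s z y := by
  classical
  have := hs.simplyConnectedSpace
  have := hD.locallyPathConnectedSpace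
  obtain ⟨x₀, hx₀⟩ := hs.nonempty
  have hunit (z : D) : s z z ⬝ᵥ s z z = 1 := (hdiff z z.2).self_of_nhds.2
  let e₀ : Quadric := ⟨s x₀ x₀, hunit ⟨x₀, hx₀⟩⟩
  let π : Quadric → Quotient (MulAction.orbitRel ℤˣ Quadric) := Quotient.mk _
  have hπ : Continuous π := continuous_quotient_mk'
  have hπ_eq (v w : Quadric) : π v = π w ↔ v.1 = w.1 ∨ v.1 = -w.1 := by
    have h1 : π v = π w ↔ v ∈ MulAction.orbit ℤˣ w := Quotient.eq''
    rw [h1]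
    constructor
    · rintro ⟨e, rfl⟩
      rcases Int.units_eq_one_or e with rfl | rfl
      · left; simp
      · right; change ((-1 : ℤˣ) • w).1 = _; simp [Quadric.coe_smul]
    · rintro (h | h)
      · exact ⟨1, by simp [Subtype.ext h]⟩
      · exact ⟨-1, Subtype.ext (by change ((-1 : ℤˣ) • w).1 = _; simp [Quadric.coe_smul, h])⟩
  have hcov : IsCoveringMap π :=
    (isQuotientCoveringMap_quotientMk_of_properlyDiscontinuousSMul (G := ℤˣ)
      (E := Quadric)).isCoveringMap
  -- The diagonal `z ↦ s z z` may jump in sign, but its class modulo sign agrees near each `z` with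
  -- that of the continuous `s z`.
  let Φ : D → Quotient (MulAction.orbitRel ℤˣ Quadric) := fun z => π ⟨s z z, hunit z⟩
  have hΦ : Continuous Φ := by
    rw [continuous_iff_continuousAt]
    intro z
    -- `e₀` is only a default value; near `z` the first branch applies.
    let σ : D → Quadric := fun y => if h : s z y ⬝ᵥ s z y = 1 then ⟨s z y, h⟩ else e₀
    have hev : ∀ᶠ y : D in 𝓝 z, s z y ⬝ᵥ s z y = 1 :=
      continuousAt_subtype_val.eventually ((hdiff z z.2).mono fun y hy => hy.2)
    have hσ : ContinuousAt σ z := by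
      refine Topology.IsInducing.subtypeVal.continuousAt_iff.2 ?_
      have h1 : ContinuousAt (fun y : D => s z y) z :=
        ContinuousAt.comp (f := fun y : D => (y : ℂ)) (g := s z)
          (hdiff z z.2).self_of_nhds.1.continuousAt continuousAt_subtype_val
      refine h1.congr ?_
      filter_upwards [hev] with y hy
      simp [σ, hy]
    have h2 : ContinuousAt (π ∘ σ) z := hπ.continuousAt.comp hσ
    refine h2.congr ?_
    filter_upwards [hev, continuousAt_subtype_val.eventually (hsign z z.2)] with y hy hy'
    simp only [Function.comp_apply, σ, hy, dite_true, Φ]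
    rw [eq_comm, hπ_eq]
    exact hy'
  obtain ⟨F, ⟨-, hF⟩, -⟩ := hcov.existsUnique_continuousMap_lifts ⟨Φ, hΦ⟩ ⟨x₀, hx₀⟩ e₀ rfl
  let v : ℂ → Fin 3 → ℂ := fun z => if h : z ∈ D then (F ⟨z, h⟩).1 else 0
  have hv (z : D) : v z = (F z).1 := by simp [v]
  have hvc : ContinuousOn v D := by
    rw [continuousOn_iff_continuous_domRestrict]
    convert continuous_subtype_val.comp (map_continuous F)
    ext1 z
    exact hv z
  have hvs (z : D) : v z = s z z ∨ v z = - s z z := by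
    rw [hv]
    exact (hπ_eq (F z) ⟨s z z, hunit z⟩).1 (congrFun hF z)
  have hvz {z : ℂ} (hz : z ∈ D) : ∀ᶠ y in 𝓝 z, v y = s z y ∨ v y = -s z y := by
    filter_upwards [hsign z hz, hD.mem_nhds hz] with y hy hyD
    rcases hvs ⟨y, hyD⟩ with h | h <;> rcases hy with h' | h' <;>
      simp only [h, h', neg_neg, true_or, or_true]
  refine ⟨v, fun z hz => DifferentiableAt.differentiableWithinAt ?_, fun z hz => ⟨?_, hvz hz⟩⟩
  · have hsd := (hdiff z hz).self_of_nhds.1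
    have hvc' : ContinuousAt v z := hvc.continuousAt (hD.mem_nhds hz)
    -- Near `z` this product takes only the values `±1`, so continuity fixes the sign: `v` is
    -- locally `s z` or `-s z`, hence holomorphic.
    have hdot : ContinuousAt (fun y => v y ⬝ᵥ s z y) z := by
      simp only [dotProduct]
      exact tendsto_finsetSum _ fun i _ => ((continuousAt_pi.1 hvc' i).mul
        (continuousAt_pi.1 hsd.continuousAt i))
    rcases (hvz hz).self_of_nhds with h | h
    · have h1 : v z ⬝ᵥ s z z = 1 := by rw [h]; exact (hdiff z hz).self_of_nhds.2
      have h2 : ∀ᶠ y in 𝓝 z, v y ⬝ᵥ s z y ≠ -1 := hdot.eventually_ne (by rw [h1]; norm_num)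
      refine hsd.congr_of_eventuallyEq ?_
      filter_upwards [h2, hvz hz, hdiff z hz] with y h2 h3 h4
      refine h3.resolve_right fun h5 => h2 ?_
      rw [h5, neg_dotProduct, h4.2]
    · have h1 : v z ⬝ᵥ s z z = -1 := by
        rw [h, neg_dotProduct, (hdiff z hz).self_of_nhds.2]
      have h2 : ∀ᶠ y in 𝓝 z, v y ⬝ᵥ s z y ≠ 1 := hdot.eventually_ne (by rw [h1]; norm_num)
      refine hsd.neg.congr_of_eventuallyEq ?_
      filter_upwards [h2, hvz hz, hdiff z hz] with y h2 h3 h4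
      refine h3.resolve_left fun h5 => h2 ?_
      rw [h5, h4.2]
  · rw [hv ⟨z, hz⟩]
    exact (F ⟨z, hz⟩).2

/-! ### Extension by symmetry -/

lemma differentiableAt_star_star {E : Type*} [NormedAddCommGroup E] [NormedSpace ℂ E]
    [StarAddMonoid E] [StarModule ℂ E] [ContinuousStar E] {A : ℂ → E} {z : ℂ}
    (h : DifferentiableAt ℂ A (star z)) : DifferentiableAt ℂ (fun y => star (A (star y))) z := by
  simpa [Function.comp_def] using h.star_star

/-- The function that is `A` on the upper half plane and symmetric under conjugation. -/
def symmetrize {E : Type*} [Star E] (A : ℂ → E) (z : ℂ) : E :=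
  if 0 < z.im then A z else star (A (star z))

/-- Without real points in `D` the two halves are disjoint open sets, so nothing has to be glued
across the axis. -/
lemma isHoloStem_symmetrize {E : Type*} [NormedAddCommGroup E] [NormedSpace ℂ E] [StarAddMonoid E]
    [StarModule ℂ E] [ContinuousStar E] {D : Set ℂ} (hD : IsOpen D)
    (hsymm : ∀ z ∈ D, star z ∈ D) (hreal : ∀ z ∈ D, z.im ≠ 0)
    {A : ℂ → E} (hA : DifferentiableOn ℂ A (D ∩ {z | 0 < z.im})) :
    IsHoloStem D (symmetrize A) := by
  have hup : IsOpen {z : ℂ | 0 < z.im} := isOpen_lt continuous_const Complex.continuous_im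
  have hdown : IsOpen {z : ℂ | z.im < 0} := isOpen_lt Complex.continuous_im continuous_const
  refine ⟨fun z hz => DifferentiableAt.differentiableWithinAt ?_, fun z hz => ?_⟩
  · rcases (hreal z hz).lt_or_gt with h | h
    · refine DifferentiableAt.congr_of_eventuallyEq (differentiableAt_star_star
        (hA.differentiableAt ((hD.inter hup).mem_nhds ⟨hsymm z hz, by simpa using h⟩))) ?_
      filter_upwards [hdown.mem_nhds h] with y hy
      have hy : y.im < 0 := hy
      simp [symmetrize, hy.le.not_gt]
    · refine (hA.differentiableAt ((hD.inter hup).mem_nhds ⟨hz, h⟩)).congr_of_eventuallyEq ?_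
      filter_upwards [hup.mem_nhds h] with y hy
      exact if_pos hy
  · rcases (hreal z hz).lt_or_gt with h | h
    · simp [symmetrize, h, h.le.not_gt]
    · simp [symmetrize, h, h.le.not_gt]

/-! ### Minimal representatives -/

/-- Write `H = (y - z) ^ n • g` with `g z ≠ 0`. At a real `z` both factors are already symmetric,
`g` by cancelling the power away from `z` and by continuity at `z`. At a nonreal `z` both are
reflected from a disc off the axis. -/
lemma exists_local_factorization {U : Set (Quaternion ℝ)} (hU : IsAxOpen U) {z : ℂ}
    (him : 0 ≤ z.im) (hz : z ∈ sliceSet unitI U) {H : ℂ → Fin 3 → ℂ}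
    (hH : IsHoloStem (sliceSet unitI U) H) (hne : ¬ ∀ᶠ y in 𝓝 z, H y = 0) :
    ∃ V, IsAxDomain V ∧ V ⊆ U ∧ z ∈ sliceSet unitI V ∧ ∃ (a : ℂ → ℂ) (W : ℂ → Fin 3 → ℂ),
      IsHoloStem (sliceSet unitI V) a ∧ IsHoloStem (sliceSet unitI V) W ∧
      ∀ y ∈ sliceSet unitI V, W y ≠ 0 ∧ H y = a y • W y := by
  have hD := isOpen_sliceSet hU.1 unitI
  have han : AnalyticAt ℂ H z := hH.1.analyticAt (hD.mem_nhds hz)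
  obtain ⟨n, g, hg, hg0, hHg⟩ := han.exists_eventuallyEq_pow_smul_nonzero_iff.2 hne
  have hev : ∀ᶠ y in 𝓝 z, y ∈ sliceSet unitI U ∧ H y = (y - z) ^ n • g y ∧
      DifferentiableAt ℂ g y ∧ g y ≠ 0 := by
    filter_upwards [hD.mem_nhds hz, hHg, hg.eventually_analyticAt,
      hg.continuousAt.eventually_ne hg0] with y h1 h2 h3 h4
    exact ⟨h1, h2, h3.differentiableAt, h4⟩
  obtain ⟨r₀, hr₀, hball⟩ := Metric.eventually_nhds_iff_ball.1 hev
  have hfold := fold_of_nonneg him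
  have hmem {r : ℝ} {y : ℂ} : y ∈ sliceSet unitI (axBall z r) ↔ fold y ∈ Metric.ball z r := by
    rw [mem_sliceSet_axBall, hfold]
  have hsub {r : ℝ} (hr : r ≤ r₀) : axBall z r ⊆ U := fun q hq => by
    refine (sliceCoord_mem_iff hU.2).1 (hball _ (Metric.ball_subset_ball hr ?_)).1
    have : sliceCoord q ∈ Metric.ball (fold z) r := hq
    rwa [hfold] at this
  rcases him.eq_or_lt with h0 | hpos
  · have hstar : star z = z := by apply Complex.ext <;> simp [← h0]
    have hstar_mem {y : ℂ} (hy : y ∈ Metric.ball z r₀) : star y ∈ Metric.ball z r₀ := by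
      rw [Metric.mem_ball] at hy ⊢
      rwa [← hstar, dist_star_star]
    have hmem' {y : ℂ} : y ∈ sliceSet unitI (axBall z r₀) ↔ y ∈ Metric.ball z r₀ := by
      rw [hmem]
      rcases fold_eq_or y with e | e <;> rw [e]
      exact ⟨fun h => by simpa using hstar_mem h, hstar_mem⟩
    have hgstar : ∀ y ∈ Metric.ball z r₀, y ≠ z → g (star y) = star (g y) := by
      intro y hy hyz
      have h1 := (hball y hy).2.1
      have h2 := (hball _ (hstar_mem hy)).2.1
      rw [hH.2 y (hball y hy).1, h1] at h2
      have h3 : star y - z = star (y - z) := by rw [star_sub, hstar]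
      rw [h3, star_smul, star_pow] at h2
      refine (smul_right_injective _ (pow_ne_zero n ?_) h2).symm
      exact star_ne_zero.2 (sub_ne_zero.2 hyz)
    refine ⟨axBall z r₀, isAxDomain_axBall z hr₀, hsub le_rfl,
      slicePoint_self_mem_axBall unitI_mem z hr₀, fun y => (y - z) ^ n, g, ⟨by fun_prop, ?_⟩,
      ⟨fun y hy => (hball y (hmem'.1 hy)).2.2.1.differentiableWithinAt, ?_⟩, fun y hy => ?_⟩
    · intro y _
      rw [star_pow, star_sub, hstar]
    · intro y hy
      rcases ne_or_eq y z with hyz | rfl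
      · exact hgstar y (hmem'.1 hy) hyz
      · have hgc : ContinuousAt g y := hg.continuousAt
        have hgc' : ContinuousAt (fun x => g (star x)) y :=
          ContinuousAt.comp (by rwa [hstar]) continuous_star.continuousAt
        have heq : (fun x => g (star x)) =ᶠ[𝓝[≠] y] fun x => star (g x) := by
          filter_upwards [self_mem_nhdsWithin,
            mem_nhdsWithin_of_mem_nhds (Metric.ball_mem_nhds y hr₀)] with x hx hx'
          exact hgstar x hx' hx
        exact tendsto_nhds_unique (hgc'.continuousWithinAt.tendsto.congr' heq)
          (hgc.star.continuousWithinAt.tendsto)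
    · have := hball y (hmem'.1 hy)
      exact ⟨this.2.2.2, this.2.1⟩
  -- The bound `z.im` keeps the disc inside the open upper half plane.
  · let r := min r₀ z.im
    have hr : 0 < r := lt_min hr₀ hpos
    have hball' {y : ℂ} (hy : y ∈ Metric.ball z r) : y ∈ Metric.ball z r₀ ∧ 0 < y.im := by
      refine ⟨Metric.ball_subset_ball (min_le_left _ _) hy, ?_⟩
      have h1 : ‖y - z‖ < z.im :=
        (mem_ball_iff_norm.1 hy).trans_le (min_le_right _ _)
      have h2 := (abs_le.1 (Complex.abs_im_le_norm (y - z))).1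
      rw [Complex.sub_im] at h2
      linarith
    have hV := isAxDomain_axBall z hr
    have hreal : ∀ y ∈ sliceSet unitI (axBall z r), y.im ≠ 0 := fun y hy h => by
      have := (hball' (hmem.1 hy)).2
      simp [fold, h] at this
    have hup {y : ℂ} (hy : y ∈ sliceSet unitI (axBall z r)) (h : 0 < y.im) :
        y ∈ Metric.ball z r₀ := by
      have := (hball' (hmem.1 hy)).1
      rwa [fold_of_nonneg h.le] at this
    have hsymm : ∀ y ∈ sliceSet unitI (axBall z r), star y ∈ sliceSet unitI (axBall z r) :=
      fun y hy => (star_mem_iff hV.1.2).2 hy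
    have hopen := isOpen_sliceSet hV.1.1 unitI
    have hsub' := hsub (min_le_left r₀ z.im)
    refine ⟨axBall z r, hV, hsub', slicePoint_self_mem_axBall unitI_mem z hr,
      symmetrize fun y => (y - z) ^ n, symmetrize g,
      isHoloStem_symmetrize hopen hsymm hreal (by fun_prop),
      isHoloStem_symmetrize hopen hsymm hreal fun y hy =>
        (hball y (hup hy.1 hy.2)).2.2.1.differentiableWithinAt, fun y hy => ?_⟩
    rcases (hreal y hy).lt_or_gt with h | h
    · have hs := hball _ (hup (hsymm y hy) (by simpa using h))
      simp only [symmetrize, h.le.not_gt, if_false]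
      refine ⟨star_ne_zero.2 hs.2.2.2, ?_⟩
      rw [← star_smul, ← hs.2.1, hH.2 y (hsub' hy), star_star]
    · have hs := hball _ (hup hy h)
      simp only [symmetrize, h, if_true]
      exact ⟨hs.2.2.2, hs.2.1⟩

/-- A nonzero vectorial value `W` with `W ⬝ W = 0` vanishes at some point of the sphere. -/
lemma exists_phi_eq_zero {v : Fin 3 → ℂ} (hv : v ≠ 0) (h : v ⬝ᵥ v = 0) :
    ∃ J ∈ imagUnits, phi J (ofVec v) = 0 := by
  set a := rePart (ofVec v) with ha
  set b := imPart (ofVec v) with hb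
  have hv' : ofVec v = mkC a b := rfl
  have hre := congrArg Complex.re h
  have him := congrArg Complex.im h
  simp only [dotProduct, Fin.sum_univ_three, Complex.add_re, Complex.mul_re, Complex.zero_re,
    Complex.add_im, Complex.mul_im, Complex.zero_im] at hre him
  have hna : Quaternion.normSq a = (v 0).re ^ 2 + (v 1).re ^ 2 + (v 2).re ^ 2 := by
    rw [Quaternion.normSq_def']; simp [ha]
  have hnb : Quaternion.normSq b = (v 0).im ^ 2 + (v 1).im ^ 2 + (v 2).im ^ 2 := by
    rw [Quaternion.normSq_def']; simp [hb]
  have hab : Quaternion.normSq a = Quaternion.normSq b := by rw [hna, hnb]; linarith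
  have hb0 : b ≠ 0 := by
    intro h0
    have ha0 : a = 0 := by rw [← Quaternion.normSq_eq_zero, hab, h0]; simp
    apply hv
    rw [← ofVec_eq_zero, hv', ha0, h0]
    ext <;> rfl
  -- The equation `a + J b = 0` leaves only this `J`. The real part of `v ⬝ v = 0` says `‖a‖ = ‖b‖`,
  -- so `J` has norm one; the imaginary part says that `a` and `b` are orthogonal, so `J` has no
  -- real part.
  refine ⟨-(a * b⁻¹), imagUnits_iff.2 ⟨?_, ?_⟩, ?_⟩
  · have : (a * star b).re = 0 := by
      simp [ha, hb]
      linarith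
    rw [Quaternion.inv_def, mul_smul_comm]
    simp only [Quaternion.re_neg, Quaternion.re_smul, this]
    simp
  · rw [norm_neg, norm_mul, norm_inv]
    have h1 : ‖a‖ = ‖b‖ := by
      rw [Quaternion.normSq_eq_norm_mul_self, Quaternion.normSq_eq_norm_mul_self] at hab
      exact (mul_self_inj (norm_nonneg _) (norm_nonneg _)).1 hab
    rw [h1, mul_inv_cancel₀ (norm_ne_zero_iff.2 hb0)]
  · rw [phi, ← ha, ← hb, neg_mul, mul_assoc, inv_mul_cancel₀ hb0, mul_one, add_neg_cancel]

namespace VectorialClass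

variable {Ω : Set (Quaternion ℝ)} {ω : VectorialClass Ω}

/-- If a representative has the stem function `a W`, where `W` vanishes nowhere, then `W` also
induces a representative. -/
lemma mem_cls_of_factorization (hΩ : IsAxDomain Ω) (hω : ¬ ω.IsNull) {z : ℂ}
    {V : Set (Quaternion ℝ)} (hV : IsAxDomain V) (hVΩ : V ⊆ Ω) (hz : z ∈ sliceSet unitI V)
    {f : Quaternion ℝ → Quaternion ℝ} (hm : (V, f) ∈ ω.cls (slicePoint unitI z))
    {H W : ℂ → Fin 3 → ℂ} {a : ℂ → ℂ} (hH : IsHoloStem (sliceSet unitI V) H)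
    (hHf : Induces V (fun z => ofVec (H z)) f)
    (ha : IsHoloStem (sliceSet unitI V) a) (hW : IsHoloStem (sliceSet unitI V) W)
    (hW0 : ∀ y ∈ sliceSet unitI V, W y ≠ 0) (hHW : ∀ y ∈ sliceSet unitI V, H y = a y • W y)
    {p : Quaternion ℝ} (hp : p ∈ V) :
    (V, induced fun z => ofVec (W z)) ∈ ω.cls p := by
  have hWi := induces_vec hW
  have hpΩ := hVΩ hp
  obtain ⟨U₁, f₁, hl₁, e⟩ := ω.isClass p hpΩ
  have hm₁ : (U₁, f₁) ∈ ω.cls p := by rw [e]; exact ⟨hl₁, EquivAt.refl hl₁⟩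
  obtain ⟨U₂, hU₂, hpU₂, hU₂₁, hU₂Ω, hm₂⟩ := ω.exists_domain_mem_cls hΩ.1 hpΩ hm₁
  obtain ⟨W₁, hW₁, hpW₁, hWU, hd, hiff⟩ := ω.compat p hpΩ _ (hVΩ hz) U₂ f₁ V f hU₂ hV hU₂Ω hVΩ hm₂
    hm p ⟨hpU₂, hp⟩
  have hWV : W₁ ⊆ V := fun q hq => (hWU hq).2
  have hsV : sliceSet unitI W₁ ⊆ sliceSet unitI V := fun y hy => hWV hy
  have hWU₁ : W₁ ⊆ U₁ := fun q hq => hU₂₁ (hWU hq).1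
  rw [e]
  refine ⟨⟨hV.1, hp, mem_SRVec_of_induces hV.1.2 hW hWi⟩, W₁, hW₁, hpW₁,
    fun q hq => ⟨hWU₁ hq, hWV hq⟩, ?_, ?_⟩
  · obtain ⟨F, hF, hFf⟩ := exists_vec_stem hW₁.1.2 (SRVec.mono hl₁.1.2 hW₁.1.2 hWU₁ hl₁.2.2)
    obtain ⟨A, B, hA, hB, ⟨y, hy, hne⟩, h0⟩ := (linDep_iff hW₁.1.2 hFf (hHf.mono hWV)).1 hd
    refine (linDep_iff hW₁.1.2 hFf (hWi.mono hWV)).2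
      ⟨A, fun x => B x * a x, hA, hB.mul (ha.mono hsV), ?_, fun x hx => ?_⟩
    -- When `B` is not identically zero, neither is `B a`: the zeros of `B` and of `H = a W` are
    -- isolated, so some point avoids both.
    · by_cases hB0 : ∃ x ∈ sliceSet unitI W₁, B x ≠ 0
      · have h1 := hB.eventually_ne_zero hW₁ hB0 hy
        have hH0 : ∃ x ∈ sliceSet unitI V, H x ≠ 0 := by
          obtain ⟨x, hx⟩ := ((eventually_ne_zero_of_mem hΩ hω (hVΩ hz) hm hH hHf).and
            (mem_nhdsWithin_of_mem_nhds ((isOpen_sliceSet hV.1.1 unitI).mem_nhds hz))).exists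
          exact ⟨x, hx.2, hx.1⟩
        have h2 := hH.eventually_ne_zero hV hH0 (hsV hy)
        have h3 : ∀ᶠ x in 𝓝[≠] y, x ∈ sliceSet unitI W₁ :=
          mem_nhdsWithin_of_mem_nhds ((isOpen_sliceSet hW₁.1.1 unitI).mem_nhds hy)
        obtain ⟨x, hx1, hx2, hx3⟩ := (h1.and (h2.and h3)).exists
        refine ⟨x, hx3, Or.inr (mul_ne_zero hx1 fun hax => hx2 ?_)⟩
        rw [hHW x (hsV hx3), hax, zero_smul]
      · push Not at hB0
        exact ⟨y, hy, Or.inl (hne.resolve_right fun h => h (hB0 y hy))⟩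
    · rw [mul_smul, ← hHW x (hsV hx)]
      exact h0 x hx
  · have hz' : slicePoint unitI z ∈ V := hz
    have hf0 : ¬ ∀ q ∈ W₁, f q = 0 := by
      rw [SRVec.zero_iff_of_subset hV hW₁.1 ⟨p, hpW₁⟩ hWV (mem_SRVec_of_induces hV.1.2 hH hHf),
        ← NullAt.of_mem hΩ.1 (hVΩ hz) hV hVΩ hm hz']
      exact not_nullAt hΩ hω (hVΩ hz)
    refine iff_of_false (fun h => hf0 (hiff.1 h)) fun h => ?_
    rw [(hWi.mono hWV).zero_iff hW₁.1.2] at h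
    obtain ⟨y, hy⟩ := sliceSet_nonempty hW₁.1.2 hW₁.2.nonempty
    exact hW0 y (hsV hy) (ofVec_eq_zero.1 (h y hy))

/-- If `Z(ω) = ∅`, then near every point there is a representative with nowhere vanishing
symmetrization. -/
lemma exists_rep_dotProduct_ne_zero (hΩ : IsAxDomain Ω) (hω : ¬ ω.IsNull)
    (hZ : ω.zeroSet ∩ Ω = ∅) {z : ℂ} (hz : z ∈ sliceSet unitI Ω) :
    ∃ (V : Set (Quaternion ℝ)) (W : ℂ → Fin 3 → ℂ), IsAxDomain V ∧ V ⊆ Ω ∧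
      z ∈ sliceSet unitI V ∧ IsHoloStem (sliceSet unitI V) W ∧
      (∀ y ∈ sliceSet unitI V, W y ⬝ᵥ W y ≠ 0) ∧
      ∀ p ∈ V, (V, induced fun y => ofVec (W y)) ∈ ω.cls p := by
  -- The local factorization requires a centre in the closed upper half plane.
  have hzf := (fold_mem_iff hΩ.1.2).2 hz
  obtain ⟨U₁, f, hm₁⟩ := ω.exists_mem_cls hzf
  obtain ⟨U, hU, hpU, -, hUΩ, hm⟩ := ω.exists_domain_mem_cls hΩ.1 hzf hm₁
  obtain ⟨H, hH, hHf⟩ := exists_vec_stem hU.1.2 (ω.isLocalVec_of_mem hzf hm).2.2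
  have hne := eventually_ne_zero_of_mem hΩ hω hzf hm hH hHf
  obtain ⟨V, hV, hVU, hzV, a, W, ha, hW, hWH⟩ := exists_local_factorization hU.1
    (z := fold z) (abs_nonneg _) hpU hH fun h => by
      obtain ⟨x, hx⟩ := (hne.and (h.filter_mono nhdsWithin_le_nhds)).exists
      exact hx.1 hx.2
  have hVΩ := hVU.trans hUΩ
  have hmem {p} (hp : p ∈ V) : (V, induced fun y => ofVec (W y)) ∈ ω.cls p :=
    mem_cls_of_factorization hΩ hω hV hVΩ hzV (ω.mem_of_subset hzf hm hV.1 hzV hVU)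
      (hH.mono fun y hy => hVU hy) (hHf.mono hVU) ha hW (fun y hy => (hWH y hy).1)
      (fun y hy => (hWH y hy).2) hp
  have hWi := induces_vec hW
  refine ⟨V, W, hV, hVΩ, (fold_mem_iff hV.1.2).1 hzV, hW, fun y hy h0 => ?_, fun p hp => hmem hp⟩
  obtain ⟨J, hJ, hJ0⟩ := exists_phi_eq_zero (hWH y hy).1 h0
  have hyV : slicePoint J y ∈ V := (slicePoint_mem_iff hV.1.2 hJ).2 hy
  have hnz {x : ℂ} (hx : x ∈ sliceSet unitI V) :
      ∃ J ∈ imagUnits, induced (fun y => ofVec (W y)) (slicePoint J x) ≠ 0 := by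
    by_contra! hcon
    refine (hWH x hx).1 (ofVec_eq_zero.1 (eq_zero_of_phi_eq_zero unitI_mem ?_ ?_))
    · rw [← hWi x hx _ unitI_mem]; exact hcon _ unitI_mem
    · have hn := neg_mem_imagUnits unitI_mem
      rw [← hWi x hx _ hn]; exact hcon _ hn
  have : slicePoint J y ∈ ω.zeroSet ∩ Ω := by
    refine ⟨⟨V, _, hV.1, hVΩ, ⟨mem_SRVec_of_induces hV.1.2 hW hWi, fun p hp => hmem hp,
      fun x hx => ?_, fun x hx _ => hnz hx⟩, hyV, ?_⟩, hVΩ hyV⟩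
    · have hs (J : Quaternion ℝ) : slicePoint J (x : ℂ) = x := by simp [slicePoint]
      have hxV : (x : ℂ) ∈ sliceSet unitI V := by
        change slicePoint unitI (x : ℂ) ∈ V
        rwa [hs]
      obtain ⟨J, -, h⟩ := hnz hxV
      rwa [hs] at h
    · rw [hWi y hy J hJ, hJ0]
  rw [hZ] at this
  exact this

end VectorialClass

/-! ### The unit vectorial function of a class without zeros -/

namespace VectorialClass

variable {Ω : Set (Quaternion ℝ)} {ω : VectorialClass Ω}

/-- Near `z`, all representatives of the class at `z` are multiples of the unit vector field `s`. -/
def Aligned (ω : VectorialClass Ω) (z : ℂ) (s : ℂ → Fin 3 → ℂ) : Prop :=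
  ∀ V f (H : ℂ → Fin 3 → ℂ), (V, f) ∈ ω.cls (slicePoint unitI z) →
    IsHoloStem (sliceSet unitI V) H → Induces V (fun y => ofVec (H y)) f →
    ∀ᶠ y in 𝓝 z, H y = (H y ⬝ᵥ s y) • s y

/-- A dependence `A W + B H = 0` gives `B` times the claimed identity. As `W` has no zeros, `B` is
not identically zero, so the identity holds off the isolated zeros of `B`, and at `z` by
analyticity. -/
lemma parallel_of_mem (hΩ : IsAxDomain Ω) {V : Set (Quaternion ℝ)} (hV : IsAxDomain V)
    (hVΩ : V ⊆ Ω) {W : ℂ → Fin 3 → ℂ} (hW : IsHoloStem (sliceSet unitI V) W)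
    (hW0 : ∀ y ∈ sliceSet unitI V, W y ⬝ᵥ W y ≠ 0) {z : ℂ} (hz : z ∈ sliceSet unitI V)
    (hm : (V, induced fun y => ofVec (W y)) ∈ ω.cls (slicePoint unitI z))
    {V' : Set (Quaternion ℝ)} {f : Quaternion ℝ → Quaternion ℝ}
    (hm' : (V', f) ∈ ω.cls (slicePoint unitI z)) {H : ℂ → Fin 3 → ℂ}
    (hH : IsHoloStem (sliceSet unitI V') H) (hHf : Induces V' (fun y => ofVec (H y)) f) :
    ∀ᶠ y in 𝓝 z, (W y ⬝ᵥ W y) • H y = (H y ⬝ᵥ W y) • W y := by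
  have hzΩ := hVΩ hz
  obtain ⟨V₁, hV₁, hpV₁, hV₁V', hV₁Ω, hm₁⟩ := ω.exists_domain_mem_cls hΩ.1 hzΩ hm'
  obtain ⟨X, hX, hpX, hXV, hd, -⟩ := ω.compat _ hzΩ _ hzΩ V _ V₁ f hV hV₁ hVΩ hV₁Ω hm hm₁ _
    ⟨hz, hpV₁⟩
  have h1 : sliceSet unitI X ⊆ sliceSet unitI V := fun y hy => (hXV hy).1
  have h2 : sliceSet unitI X ⊆ sliceSet unitI V' := fun y hy => hV₁V' (hXV hy).2
  obtain ⟨A, B, hA, hB, ⟨y, hy, hne⟩, h0⟩ := (linDep_iff hX.1.2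
    ((induces_vec hW).mono fun q hq => (hXV hq).1)
    (hHf.mono fun q hq => hV₁V' (hXV hq).2)).1 hd
  have hWne {x : ℂ} (hx : x ∈ sliceSet unitI X) : W x ≠ 0 := fun h =>
    hW0 x (h1 hx) (by rw [h, zero_dotProduct])
  have hB0 : B y ≠ 0 := fun hB0 => by
    have := h0 y hy
    rw [hB0, zero_smul, add_zero, smul_eq_zero] at this
    rcases hne with h | h
    exacts [h (this.resolve_right (hWne hy)), h hB0]
  have hzX : z ∈ sliceSet unitI X := hpX
  have hDX := isOpen_sliceSet hX.1.1 unitI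
  have hW' := hW.mono h1
  have hH' := hH.mono h2
  have han : AnalyticAt ℂ (fun y => (W y ⬝ᵥ W y) • H y - (H y ⬝ᵥ W y) • W y) z :=
    (((hW'.dotProduct hW').smul hH').1.sub ((hH'.dotProduct hW').smul hW').1).analyticAt
      (hDX.mem_nhds hzX)
  have hpunct : ∀ᶠ y in 𝓝[≠] z, (W y ⬝ᵥ W y) • H y - (H y ⬝ᵥ W y) • W y = 0 := by
    filter_upwards [hB.eventually_ne_zero hX ⟨y, hy, hB0⟩ hzX,
      mem_nhdsWithin_of_mem_nhds (hDX.mem_nhds hzX)] with x hx hxX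
    have e1 : B x • H x = -(A x • W x) := eq_neg_of_add_eq_zero_right (h0 x hxX)
    have e2 : B x * (H x ⬝ᵥ W x) = -(A x * (W x ⬝ᵥ W x)) := by
      rw [← smul_eq_mul, ← smul_dotProduct, e1, neg_dotProduct, smul_dotProduct, smul_eq_mul]
    have e3 : B x • ((W x ⬝ᵥ W x) • H x - (H x ⬝ᵥ W x) • W x) = 0 := by
      rw [smul_sub, smul_comm, e1, smul_smul, e2]
      module
    exact (smul_eq_zero.1 e3).resolve_left hx
  filter_upwards [han.frequently_zero_iff_eventually_zero.1 hpunct.frequently] with y hy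
  exact sub_eq_zero.1 hy

lemma exists_aligned (hΩ : IsAxDomain Ω) (hω : ¬ ω.IsNull) (hZ : ω.zeroSet ∩ Ω = ∅) {z : ℂ}
    (hz : z ∈ sliceSet unitI Ω) :
    ∃ s : ℂ → Fin 3 → ℂ, ∀ᶠ y in 𝓝 z, DifferentiableAt ℂ s y ∧ s y ⬝ᵥ s y = 1 ∧ ω.Aligned y s := by
  obtain ⟨V, W, hV, hVΩ, hzV, hW, hW0, hm⟩ := exists_rep_dotProduct_ne_zero hΩ hω hZ hz
  have hD := isOpen_sliceSet hV.1.1 unitI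
  let N : ℂ → ℂ := fun y => W y ⬝ᵥ W y
  have hN : DifferentiableOn ℂ N (sliceSet unitI V) := (hW.dotProduct hW).1
  have hN0 := hW0 z hzV
  obtain ⟨c, hc⟩ := IsAlgClosed.exists_pow_nat_eq (N z) two_pos
  -- A square root of `N`: dividing by `N z` brings the argument of the logarithm close to `1`, away
  -- from the cut, and `c` restores the factor. The identity `κ ^ 2 = N` holds on the whole slice,
  -- differentiability only near `z`.
  let κ : ℂ → ℂ := fun y => c * Complex.exp (Complex.log (N y / N z) / 2)
  have hκ {y : ℂ} (hy : y ∈ sliceSet unitI V) : κ y ^ 2 = N y := by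
    have h1 : N y / N z ≠ 0 := div_ne_zero (hW0 y hy) hN0
    rw [mul_pow, ← Complex.exp_nat_mul, hc]
    rw [show ((2 : ℕ) : ℂ) * (Complex.log (N y / N z) / 2) = Complex.log (N y / N z) by
      push_cast; ring, Complex.exp_log h1, mul_div_cancel₀ _ hN0]
  have hκ0 {y : ℂ} (hy : y ∈ sliceSet unitI V) : κ y ≠ 0 := fun h => by
    have := hκ hy
    rw [h] at this
    exact hW0 y hy (by simpa using this.symm)
  have hslit : ∀ᶠ y in 𝓝 z, N y / N z ∈ Complex.slitPlane := by
    have h1 : ContinuousAt (fun y => N y / N z) z :=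
      ((hN.differentiableAt (hD.mem_nhds hzV)).div_const _).continuousAt
    refine h1.eventually (Complex.isOpen_slitPlane.mem_nhds ?_)
    change N z / N z ∈ _
    rw [div_self hN0]
    exact Complex.one_mem_slitPlane
  refine ⟨fun y => (κ y)⁻¹ • W y, ?_⟩
  filter_upwards [hslit, hD.mem_nhds hzV] with y hy hyV
  refine ⟨?_, ?_, ?_⟩
  · have h1 := hN.differentiableAt (hD.mem_nhds hyV)
    have h2 := hW.1.differentiableAt (hD.mem_nhds hyV)
    have h3 : DifferentiableAt ℂ κ y :=
      ((((h1.div_const _).clog hy).div_const _).cexp).const_mul _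
    exact (h3.inv (hκ0 hyV)).smul h2
  · rw [smul_dotProduct, dotProduct_smul, smul_smul, smul_eq_mul]
    change _ * N y = 1
    rw [← hκ hyV]
    have := hκ0 hyV
    field_simp
  · intro V' f H hm' hH hHf
    filter_upwards [parallel_of_mem hΩ hV hVΩ hW hW0 hyV (hm _ hyV) hm' hH hHf,
      hD.mem_nhds hyV] with x hx hxV
    have h0 := hκ0 hxV
    rw [dotProduct_smul, smul_eq_mul, smul_smul]
    have e : (κ x)⁻¹ * H x ⬝ᵥ W x * (κ x)⁻¹ = (N x)⁻¹ * (H x ⬝ᵥ W x) := by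
      rw [← hκ hxV]; field_simp
    rw [e, mul_smul, ← hx, smul_smul]
    change H x = ((N x)⁻¹ * N x) • H x
    rw [inv_mul_cancel₀ (hW0 x hxV), one_smul]

/-- Off the isolated zeros of a representative `H`, both fields are proportional to `H`, hence to
each other; two proportional unit vectors have ratio `±1`. -/
lemma Aligned.eventually_eq_or_neg (hΩ : IsAxDomain Ω) (hω : ¬ ω.IsNull) {z : ℂ}
    (hz : z ∈ sliceSet unitI Ω) {s t : ℂ → Fin 3 → ℂ} (hs : ω.Aligned z s) (ht : ω.Aligned z t)
    (hs1 : ∀ᶠ y in 𝓝 z, s y ⬝ᵥ s y = 1) (ht1 : ∀ᶠ y in 𝓝 z, t y ⬝ᵥ t y = 1) :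
    ∀ᶠ y in 𝓝[≠] z, s y = t y ∨ s y = -t y := by
  obtain ⟨V, f, hm⟩ := ω.exists_mem_cls hz
  have hl := ω.isLocalVec_of_mem hz hm
  obtain ⟨H, hH, hHf⟩ := exists_vec_stem hl.1.2 hl.2.2
  filter_upwards [eventually_ne_zero_of_mem hΩ hω hz hm hH hHf,
    mem_nhdsWithin_of_mem_nhds (hs V f H hm hH hHf), mem_nhdsWithin_of_mem_nhds (ht V f H hm hH hHf),
    mem_nhdsWithin_of_mem_nhds hs1, mem_nhdsWithin_of_mem_nhds ht1] with y h0 h1 h2 h3 h4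
  have hc : H y ⬝ᵥ s y ≠ 0 := fun h => h0 (by rw [h1, h, zero_smul])
  have h5 : s y = ((H y ⬝ᵥ s y)⁻¹ * (H y ⬝ᵥ t y)) • t y := by
    rw [mul_smul, ← h2]
    exact (eq_inv_smul_iff₀ hc).2 h1.symm
  set k := (H y ⬝ᵥ s y)⁻¹ * (H y ⬝ᵥ t y)
  rw [h5, smul_dotProduct, dotProduct_smul, h4, smul_eq_mul, smul_eq_mul, mul_one,
    mul_self_eq_one_iff] at h3
  rcases h3 with h | h
  · left; rw [h5, h, one_smul]
  · right; rw [h5, h, neg_one_smul]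

/-- The representative may vanish at `z` itself. One of the two signs occurs at points arbitrarily
close to `z`, and continuity carries that equality to `z`. -/
lemma Aligned.eq_or_neg (hΩ : IsAxDomain Ω) (hω : ¬ ω.IsNull) {z : ℂ}
    (hz : z ∈ sliceSet unitI Ω) {s t : ℂ → Fin 3 → ℂ} (hs : ω.Aligned z s) (ht : ω.Aligned z t)
    (hs1 : ∀ᶠ y in 𝓝 z, s y ⬝ᵥ s y = 1) (ht1 : ∀ᶠ y in 𝓝 z, t y ⬝ᵥ t y = 1)
    (hsc : ContinuousAt s z) (htc : ContinuousAt t z) : s z = t z ∨ s z = -t z := by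
  have key {u : ℂ → Fin 3 → ℂ} (huc : ContinuousAt u z) (h : ∃ᶠ y in 𝓝[≠] z, s y = u y) :
      s z = u z :=
    tendsto_nhds_unique_of_frequently_eq hsc.continuousWithinAt.tendsto
      huc.continuousWithinAt.tendsto h
  rcases frequently_or_distrib.1
    (hs.eventually_eq_or_neg hΩ hω hz ht hs1 ht1).frequently with h | h
  exacts [Or.inl (key htc h), Or.inr (key htc.neg h)]

/-- A vectorial class without zeros on a domain with real points and simply connected slice has a
global unit vectorial function. -/
lemma exists_unit_stem (hΩ : IsAxDomain Ω) (hω : ¬ ω.IsNull) (hZ : ω.zeroSet ∩ Ω = ∅)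
    (hsc : IsSimplyConnected (sliceSet unitI Ω)) {x₀ : ℂ} (hx₀ : x₀ ∈ sliceSet unitI Ω)
    (hreal : star x₀ = x₀) :
    ∃ v : ℂ → Fin 3 → ℂ, IsHoloStem (sliceSet unitI Ω) v ∧
      ∀ z ∈ sliceSet unitI Ω, v z ⬝ᵥ v z = 1 ∧ ω.Aligned z v := by
  have hD := isOpen_sliceSet hΩ.1.1 unitI
  choose! s hs using fun z (hz : z ∈ sliceSet unitI Ω) => exists_aligned hΩ hω hZ hz
  obtain ⟨v, hv, hv'⟩ := exists_global_unit hD hsc s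
    (fun z hz => (hs z hz).mono fun y hy => ⟨hy.1, hy.2.1⟩) fun z hz => by
      filter_upwards [eventually_eventually_nhds.2 (hs z hz), hD.mem_nhds hz] with y hy hyD
      exact Aligned.eq_or_neg hΩ hω hyD (hs y hyD).self_of_nhds.2.2 hy.self_of_nhds.2.2
        ((hs y hyD).mono fun x hx => hx.2.1) (hy.mono fun x hx => hx.2.1)
        (hs y hyD).self_of_nhds.1.continuousAt hy.self_of_nhds.1.continuousAt
  have hal : ∀ z ∈ sliceSet unitI Ω, ω.Aligned z v := by
    intro z hz V f H hm hH hHf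
    filter_upwards [(hs z hz).self_of_nhds.2.2 V f H hm hH hHf, (hv' z hz).2] with y h1 h2
    rcases h2 with h2 | h2 <;> rw [h2]
    · exact h1
    · rw [dotProduct_neg, neg_smul_neg]; exact h1
  -- The representatives are symmetric, so this reflected field is again aligned at `x₀`; it
  -- therefore agrees with `v` up to sign.
  let v' : ℂ → Fin 3 → ℂ := fun z => star (v (star z))
  have hstarD {z : ℂ} : star z ∈ sliceSet unitI Ω ↔ z ∈ sliceSet unitI Ω := star_mem_iff hΩ.1.2
  have hdot (a b : Fin 3 → ℂ) : star a ⬝ᵥ star b = star (a ⬝ᵥ b) := by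
    simp [dotProduct, Fin.sum_univ_three]
  have hv'd : DifferentiableOn ℂ v' (sliceSet unitI Ω) := fun z hz =>
    (differentiableAt_star_star (hv.differentiableAt
      (hD.mem_nhds (hstarD.2 hz)))).differentiableWithinAt
  have hv'1 {z : ℂ} (hz : z ∈ sliceSet unitI Ω) : v' z ⬝ᵥ v' z = 1 := by
    rw [hdot, (hv' _ (hstarD.2 hz)).1, star_one]
  have hal' : ω.Aligned x₀ v' := by
    intro V f H hm hH hHf
    have hl := ω.isLocalVec_of_mem hx₀ hm
    have hc : Tendsto (fun y : ℂ => star y) (𝓝 x₀) (𝓝 x₀) := by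
      have : Continuous fun y : ℂ => star y := continuous_star
      simpa [hreal] using this.tendsto x₀
    filter_upwards [hc.eventually (hal x₀ hx₀ V f H hm hH hHf),
      (isOpen_sliceSet hl.1.1 unitI).mem_nhds hl.2.1] with y hy hyV
    have h1 : H y = star (H (star y)) := by rw [hH.2 y hyV, star_star]
    calc H y = star ((H (star y) ⬝ᵥ v (star y)) • v (star y)) := by rw [← hy, ← h1]
      _ = (H y ⬝ᵥ v' y) • v' y := by rw [star_smul, h1, hdot]
  have hev := hal'.eventually_eq_or_neg hΩ hω hx₀ (hal x₀ hx₀)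
    (by filter_upwards [hD.mem_nhds hx₀] with y hy using hv'1 hy)
    (by filter_upwards [hD.mem_nhds hx₀] with y hy using (hv' y hy).1)
  have hpre : IsPreconnected (sliceSet unitI Ω) := hsc.isPathConnected.isConnected.isPreconnected
  have heq : Set.EqOn v' v (sliceSet unitI Ω) := by
    rcases frequently_or_distrib.1 hev.frequently with h | h
    · exact (hv'd.analyticOnNhd hD).eqOn_of_preconnected_of_frequently_eq (hv.analyticOnNhd hD)
        hpre hx₀ h
    -- If `v' = -v`, then `v x₀` is purely imaginary and `v x₀ ⬝ v x₀` has nonpositive real part,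
    -- while it equals `1`.
    · exfalso
      have h1 := (hv'd.analyticOnNhd hD).eqOn_of_preconnected_of_frequently_eq
        (hv.neg.analyticOnNhd hD) hpre hx₀ h hx₀
      have h2 (i : Fin 3) : (v x₀ i).re = 0 := by
        have h3 := congrArg Complex.re (congrFun h1 i)
        change (star (v (star x₀)) i).re = _ at h3
        rw [hreal] at h3
        simp only [Pi.star_apply, Pi.neg_apply, Complex.star_def, Complex.conj_re,
          Complex.neg_re] at h3
        linarith
      have h4 := congrArg Complex.re (hv' x₀ hx₀).1
      simp only [dotProduct, Fin.sum_univ_three, Complex.add_re, Complex.mul_re, h2,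
        Complex.one_re] at h4
      nlinarith [sq_nonneg (v x₀ 0).im, sq_nonneg (v x₀ 1).im, sq_nonneg (v x₀ 2).im]
  refine ⟨v, ⟨hv, fun z hz => ?_⟩, fun z hz => ⟨(hv' z hz).1, hal z hz⟩⟩
  rw [← heq hz, star_star]

end VectorialClass

/-! ### The `*`-exponential -/

lemma isStem_pow {Ω : Set (Quaternion ℝ)} {F : ℂ → Quaternion ℂ} (hF : IsStem Ω F) (k : ℕ) :
    IsStem Ω fun z => F z ^ k := by
  intro z hz
  induction k with
  | zero => ext <;> simp
  | succ k ih =>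
    simp only at ih ⊢
    rw [pow_succ, pow_succ, ih, hF z hz, conjC_mul]

lemma induces_starPow {Ω : Set (Quaternion ℝ)} (hΩ : AxiallySymmetric Ω) {F : ℂ → Quaternion ℂ}
    (hF : IsStem Ω F) {f : Quaternion ℝ → Quaternion ℝ} (hf : Induces Ω F f) (k : ℕ) :
    Induces Ω (fun z => F z ^ k) (starPow f k) := by
  induction k with
  | zero =>
    intro z _ J _
    simp only [starPow, pow_zero]
    ext <;> simp [phi]
  | succ k ih =>
    have hst {z} (hz : z ∈ sliceSet unitI Ω) :
        stem (starPow f k) z * stem f z = F z ^ (k + 1) := by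
      rw [stem_eq ih hz, stem_eq hf hz, pow_succ]
    refine Induces.congr (F := fun z => stem (starPow f k) z * stem f z) ?_ fun z hz => hst hz
    apply induces_induced
    intro z hz
    have hz' : starRingEnd ℂ z ∈ sliceSet unitI Ω := (star_mem_iff hΩ).2 hz
    simp only [hst hz, hst hz']
    exact isStem_pow hF (k + 1) z hz

/-- For fixed `J` the map `slicePoint J` is real-linear and continuous, so it can be applied
termwise to the complex exponential series. -/
lemma hasSum_slicePoint_exp (J : Quaternion ℝ) (a : ℂ) :
    HasSum (fun k : ℕ => ((Nat.factorial k : ℝ)⁻¹) • slicePoint J (a ^ k))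
      (slicePoint J (Complex.exp a)) := by
  have h1 : HasSum (fun k : ℕ => ((Nat.factorial k : ℝ)⁻¹) • a ^ k) (Complex.exp a) := by
    rw [Complex.exp_eq_exp_ℂ]
    exact NormedSpace.exp_series_hasSum_exp' (𝕂 := ℝ) a
  let φ : ℂ →ₗ[ℝ] Quaternion ℝ :=
    { toFun := slicePoint J
      map_add' := fun x y => by simp [slicePoint, mul_add]; abel
      map_smul' := fun r x => by
        simp only [slicePoint, RingHom.id_apply, smul_add, Complex.smul_re, Complex.smul_im,
          smul_eq_mul, Quaternion.coe_mul, ← Quaternion.coe_mul_eq_smul]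
        rw [← mul_assoc J, ← mul_assoc _ J, Quaternion.coe_commutes _ J] }
  have h2 := h1.map φ (continuous_slicePoint.comp (Continuous.prodMk_right J))
  have h3 : (φ ∘ fun k : ℕ => ((Nat.factorial k : ℝ)⁻¹) • a ^ k) =
      fun k : ℕ => ((Nat.factorial k : ℝ)⁻¹) • slicePoint J (a ^ k) :=
    funext fun k => φ.map_smul _ _
  rwa [h3] at h2

/-- Multiply `1 = E + E'` repeatedly by `Z`, using that complex scalars are central. Idempotency of
`E` and `E'` is not needed. -/
lemma pow_eq_of_eigen {Z E E' : Quaternion ℂ} {a b : ℂ} (h1 : E + E' = 1)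
    (hE : Z * E = a * E) (hE' : Z * E' = b * E') (k : ℕ) :
    Z ^ k = ((a ^ k : ℂ) : Quaternion ℂ) * E + ((b ^ k : ℂ) : Quaternion ℂ) * E' := by
  induction k with
  | zero => simp [h1]
  | succ k ih =>
    rw [pow_succ' Z, ih, mul_add, ← mul_assoc, ← mul_assoc, ← Quaternion.coe_commutes,
      ← Quaternion.coe_commutes, mul_assoc, mul_assoc, hE, hE', ← mul_assoc, ← mul_assoc,
      ← Quaternion.coe_mul, ← Quaternion.coe_mul, pow_succ, pow_succ]

/-- A function whose stem function is diagonalised by complementary idempotents, with eigenvalues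
logarithms of `G`, is a `*`-logarithm of the function induced by `G`. -/
lemma isStarLog_of_eigen {Ω : Set (Quaternion ℝ)} (hΩ : AxiallySymmetric Ω)
    {F : ℂ → Quaternion ℂ} {G : ℂ → ℂ} (hF : IsStem Ω F) {f g : Quaternion ℝ → Quaternion ℝ}
    (hf : Induces Ω F f) (hg : Induces Ω (fun z => (G z : Quaternion ℂ)) g)
    (h : ∀ z ∈ sliceSet unitI Ω, ∃ (E E' : Quaternion ℂ) (a b : ℂ), E + E' = 1 ∧
      F z * E = a * E ∧ F z * E' = b * E' ∧ Complex.exp a = G z ∧ Complex.exp b = G z) :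
    IsStarLog Ω f g := by
  intro q hq
  obtain ⟨J, hJ, e⟩ := exists_slicePoint_eq q
  have hz := (sliceCoord_mem_iff hΩ).2 hq
  obtain ⟨E, E', a, b, h1, hE, hE', ha, hb⟩ := h _ hz
  rw [e, hg _ hz J hJ]
  have hs := ((hasSum_slicePoint_exp J a).mul_right (phi J E)).add
    ((hasSum_slicePoint_exp J b).mul_right (phi J E'))
  have hlim : slicePoint J (Complex.exp a) * phi J E + slicePoint J (Complex.exp b) * phi J E' =
      phi J (G (sliceCoord q) : Quaternion ℂ) := by
    rw [ha, hb, ← mul_add, ← phi_add, h1, ← phi_coe, ← phi_coe_mul hJ, mul_one]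
  rw [hlim] at hs
  refine hs.congr_fun fun k => ?_
  rw [induces_starPow hΩ hF hf k _ hz J hJ]
  simp only [pow_eq_of_eigen h1 hE hE', phi_add, phi_coe_mul hJ, phi_coe, smul_add, smul_mul_assoc]

lemma exists_isStarLog_SRReal {Ω : Set (Quaternion ℝ)} (hΩ : AxiallySymmetric Ω) {G L : ℂ → ℂ}
    {g : Quaternion ℝ → Quaternion ℝ} (hg : Induces Ω (fun z => (G z : Quaternion ℂ)) g)
    (hL : IsHoloStem (sliceSet unitI Ω) L) (hLG : ∀ z ∈ sliceSet unitI Ω, Complex.exp (L z) = G z) :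
    ∃ f ∈ SRReal Ω, IsStarLog Ω f g := by
  obtain ⟨f, hf, hfL⟩ := exists_mem_SRReal hΩ hL
  refine ⟨f, hf, isStarLog_of_eigen hΩ (fun z hz => ?_) hfL hg fun z hz =>
    ⟨1, 0, L z, L z, add_zero 1, rfl, by simp, hLG z hz, hLG z hz⟩⟩
  have := hL.2 z hz
  rw [Complex.star_def] at this
  simp only [this, conjC_coe, Complex.star_def]

/-- `L + π v` with `v ⬝ v = 1` has the `*`-exponential `-exp L`. -/
lemma isStarLog_add_pi {Ω : Set (Quaternion ℝ)} (hΩ : AxiallySymmetric Ω) {G L : ℂ → ℂ}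
    {v : ℂ → Fin 3 → ℂ} {f g : Quaternion ℝ → Quaternion ℝ}
    (hg : Induces Ω (fun z => (G z : Quaternion ℂ)) g)
    (hF : IsStem Ω fun z => (L z : Quaternion ℂ) + ofVec ((Real.pi : ℂ) • v z))
    (hf : Induces Ω (fun z => (L z : Quaternion ℂ) + ofVec ((Real.pi : ℂ) • v z)) f)
    (hLG : ∀ z ∈ sliceSet unitI Ω, Complex.exp (L z) = -G z)
    (hv : ∀ z ∈ sliceSet unitI Ω, v z ⬝ᵥ v z = 1) : IsStarLog Ω f g := by
  refine isStarLog_of_eigen hΩ hF hf hg fun z hz => ?_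
  have hu := hv z hz
  simp only [dotProduct, Fin.sum_univ_three] at hu
  have hI : Complex.I * Complex.I = -1 := Complex.I_mul_I
  -- Since `v² = -1`, one has `v (1 - I v) = I (1 - I v)`: these are the projections onto the
  -- eigenspaces of `v` for `I` and `-I`. The eigenvalues `L ± π I` both have exponential `-exp L =
  -- G`.
  refine ⟨((1 / 2 : ℂ) : Quaternion ℂ) + ofVec ((-Complex.I / 2) • v z),
    ((1 / 2 : ℂ) : Quaternion ℂ) + ofVec ((Complex.I / 2) • v z),
    L z + Real.pi * Complex.I, L z - Real.pi * Complex.I, ?_, ?_, ?_, ?_, ?_⟩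
  · ext <;> simp <;> ring
  · ext <;> simp
    · linear_combination (Real.pi * Complex.I / 2 : ℂ) * hu
    · linear_combination (Real.pi * v z 0 / 2 : ℂ) * hI
    · linear_combination (Real.pi * v z 1 / 2 : ℂ) * hI
    · linear_combination (Real.pi * v z 2 / 2 : ℂ) * hI
  · ext <;> simp
    · linear_combination (-Real.pi * Complex.I / 2 : ℂ) * hu
    · linear_combination (Real.pi * v z 0 / 2 : ℂ) * hI
    · linear_combination (Real.pi * v z 1 / 2 : ℂ) * hI
    · linear_combination (Real.pi * v z 2 / 2 : ℂ) * hI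
  · rw [Complex.exp_add, Complex.exp_pi_mul_I, hLG z hz]; ring
  · rw [Complex.exp_sub, Complex.exp_pi_mul_I, hLG z hz]; ring

/-! ### Logarithms of scalar stem functions -/

/-- Near `x` the difference has norm below `π` and exponential `1`, so it is zero there; the
identity theorem does the rest. -/
lemma eqOn_of_exp_eq {D : Set ℂ} (hD : IsOpen D) (hc : IsPreconnected D) {L M : ℂ → ℂ}
    (hL : DifferentiableOn ℂ L D) (hM : DifferentiableOn ℂ M D)
    (h : ∀ z ∈ D, Complex.exp (L z) = Complex.exp (M z)) {x : ℂ} (hx : x ∈ D) (hxx : L x = M x) :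
    Set.EqOn L M D := by
  refine (hL.analyticOnNhd hD).eqOn_of_preconnected_of_frequently_eq (hM.analyticOnNhd hD) hc hx
    (Eventually.frequently (mem_nhdsWithin_of_mem_nhds ?_))
  have hd : ContinuousAt (fun y => ‖L y - M y‖) x :=
    ((hL.sub hM).continuousOn.continuousAt (hD.mem_nhds hx)).norm
  filter_upwards [hd.eventually_lt continuousAt_const (by simp [hxx, Real.pi_pos] :
    ‖L x - M x‖ < Real.pi), hD.mem_nhds hx] with y hy hyD
  have h1 := (Complex.abs_im_le_norm (L y - M y)).trans_lt hy
  have h2 := Complex.log_exp (abs_lt.1 h1).1 (abs_lt.1 h1).2.le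
  rw [Complex.exp_sub, h y hyD, div_self (Complex.exp_ne_zero _), Complex.log_one] at h2
  exact sub_eq_zero.1 h2.symm

/-- Normalise the logarithm to be real at `x`. Its conjugate reflection is again a logarithm of `G`,
with the same value at `x`, so the two coincide. -/
lemma exists_log_stem_of_pos {D : Set ℂ} (hD : IsOpen D) (hs : IsSimplyConnected D)
    (hsymm : ∀ z ∈ D, star z ∈ D) {G : ℂ → ℂ} (hG : IsHoloStem D G) (h0 : ∀ z ∈ D, G z ≠ 0)
    {x : ℂ} (hx : x ∈ D) (hreal : star x = x) {r : ℝ} (hr : 0 < r) (hGx : G x = r) :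
    ∃ L : ℂ → ℂ, IsHoloStem D L ∧ ∀ z ∈ D, Complex.exp (L z) = G z := by
  obtain ⟨L₀, hL₀, hLG₀⟩ := exists_log hD hs hG.1 h0
  let c : ℂ := (Real.log r : ℂ) - L₀ x
  have hc : Complex.exp c = 1 := by
    rw [Complex.exp_sub, hLG₀ x hx, hGx, ← Complex.ofReal_exp, Real.exp_log hr, div_self]
    exact_mod_cast hr.ne'
  let L : ℂ → ℂ := fun z => L₀ z + c
  have hL : DifferentiableOn ℂ L D := hL₀.add_const c
  have hLG : ∀ z ∈ D, Complex.exp (L z) = G z := fun z hz => by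
    rw [Complex.exp_add, hLG₀ z hz, hc, mul_one]
  have hLx : L x = (Real.log r : ℂ) := by simp [L, c]
  have heq : Set.EqOn (fun z => star (L (star z))) L D := by
    refine eqOn_of_exp_eq hD hs.isPathConnected.isConnected.isPreconnected
      (fun z hz => (differentiableAt_star_star
        (hL.differentiableAt (hD.mem_nhds (hsymm z hz)))).differentiableWithinAt) hL
      (fun z hz => ?_) hx ?_
    · rw [hLG z hz, Complex.star_def, Complex.exp_conj, ← Complex.star_def, hLG _ (hsymm z hz),
        hG.2 z hz, star_star]
    · simp only [hreal, hLx, Complex.star_def, Complex.conj_ofReal]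
  refine ⟨L, ⟨hL, fun z hz => ?_⟩, hLG⟩
  have := heq hz
  simp only at this
  rw [← this, star_star]

/-! ### The slice of a basic domain -/

lemma isPreconnected_image_sliceCoord {Ω : Set (Quaternion ℝ)} (hΩ : IsAxDomain Ω) :
    IsPreconnected (sliceCoord '' Ω) :=
  hΩ.2.isPreconnected.image _ continuous_sliceCoord.continuousOn

lemma mem_image_sliceCoord {Ω : Set (Quaternion ℝ)} (hΩ : AxiallySymmetric Ω) {z : ℂ} :
    z ∈ sliceCoord '' Ω ↔ z ∈ sliceSet unitI Ω ∧ 0 ≤ z.im := by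
  constructor
  · rintro ⟨q, hq, rfl⟩
    exact ⟨(sliceCoord_mem_iff hΩ).2 hq, norm_nonneg _⟩
  · rintro ⟨hz, h⟩
    exact ⟨slicePoint unitI z, hz, by rw [sliceCoord_slicePoint unitI_mem, fold_of_nonneg h]⟩

/-- The slice is the union of its closed upper half, a continuous image of `Ω`, and the mirror
image; both contain `x`, so the slice is connected and is its own component. -/
lemma IsBasicDomain.isSimplyConnected_sliceSet {Ω : Set (Quaternion ℝ)} (hΩ : IsBasicDomain Ω)
    {x : ℂ} (hx : x ∈ sliceSet unitI Ω) (hreal : star x = x) :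
    IsSimplyConnected (sliceSet unitI Ω) := by
  have h1 := isPreconnected_image_sliceCoord hΩ.1
  have him : x.im = 0 := Complex.conj_eq_iff_im.1 hreal
  have hx' : x ∈ sliceCoord '' Ω := (mem_image_sliceCoord hΩ.1.1.2).2 ⟨hx, him.ge⟩
  have h2 := h1.image (fun z : ℂ => star z) continuous_star.continuousOn
  have hpre : IsPreconnected (sliceSet unitI Ω) := by
    have hx'' : x ∈ (fun z : ℂ => star z) '' (sliceCoord '' Ω) := ⟨x, hx', hreal⟩
    convert IsPreconnected.union x hx' hx'' h1 h2
    ext z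
    rw [Set.mem_union, mem_image_sliceCoord hΩ.1.1.2]
    constructor
    · intro hz
      rcases le_total 0 z.im with h | h
      · exact Or.inl ⟨hz, h⟩
      · exact Or.inr ⟨star z, (mem_image_sliceCoord hΩ.1.1.2).2
          ⟨(star_mem_iff hΩ.1.1.2).2 hz, by simpa using h⟩, star_star z⟩
    · rintro (h | ⟨y, hy, rfl⟩)
      · exact h.1
      · exact (star_mem_iff hΩ.1.1.2).2 ((mem_image_sliceCoord hΩ.1.1.2).1 hy).1
  have := hΩ.2 unitI unitI_mem x hx
  rwa [hpre.connectedComponentIn hx] at this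

/-- The upper half is the image of `Ω` under `sliceCoord`, hence connected. A component reaching
below the axis would contain a real point, so the upper half is a full component. -/
lemma IsBasicDomain.isSimplyConnected_upper {Ω : Set (Quaternion ℝ)} (hΩ : IsBasicDomain Ω)
    (hreal : ∀ z ∈ sliceSet unitI Ω, z.im ≠ 0) :
    IsSimplyConnected (sliceSet unitI Ω ∩ {z | 0 < z.im}) := by
  have himg : sliceCoord '' Ω = sliceSet unitI Ω ∩ {z | 0 < z.im} := by
    ext z
    rw [mem_image_sliceCoord hΩ.1.1.2]
    exact and_congr_right fun hz => ⟨fun h => h.lt_of_ne (hreal z hz).symm, fun h => le_of_lt h⟩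
  have h1 := isPreconnected_image_sliceCoord hΩ.1
  rw [himg] at h1
  obtain ⟨q, hq⟩ := hΩ.1.2.nonempty
  have hz : sliceCoord q ∈ sliceSet unitI Ω ∩ {z | 0 < z.im} := himg ▸ ⟨q, hq, rfl⟩
  convert hΩ.2 unitI unitI_mem _ hz.1
  apply Set.Subset.antisymm
  · exact h1.subset_connectedComponentIn hz Set.inter_subset_left
  · have hsub := connectedComponentIn_subset (sliceSet unitI Ω) (sliceCoord q)
    refine fun y hy => ⟨hsub hy, ?_⟩
    by_contra hneg
    have hint := isPreconnected_connectedComponentIn.intermediate_value hy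
      (mem_connectedComponentIn hz.1) Complex.continuous_im.continuousOn
    obtain ⟨w, hw, hw0⟩ := hint ⟨not_lt.1 hneg, le_of_lt hz.2⟩
    exact hreal w (hsub hw) hw0

/-! ### Membership in `𝒮ℛ_ω` -/

namespace VectorialClass

variable {Ω : Set (Quaternion ℝ)} {ω : VectorialClass Ω}

/-- Compatibility at `p'` between `h` and a representative of the class at `p'` is exactly what
membership requires. -/
lemma mem_cls_of_mem_domain (hΩ : IsAxOpen Ω) {p p' : Quaternion ℝ} (hp : p ∈ Ω)
    {V : Set (Quaternion ℝ)} {h : Quaternion ℝ → Quaternion ℝ} (hV : IsAxDomain V) (hVΩ : V ⊆ Ω)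
    (hm : (V, h) ∈ ω.cls p) (hp' : p' ∈ V) : (V, h) ∈ ω.cls p' := by
  have hl := ω.isLocalVec_of_mem hp hm
  obtain ⟨U₁, f₁, hl₁, e⟩ := ω.isClass p' (hVΩ hp')
  have hm₁ : (U₁, f₁) ∈ ω.cls p' := by rw [e]; exact ⟨hl₁, EquivAt.refl hl₁⟩
  obtain ⟨U₂, hU₂, hpU₂, hU₂₁, hU₂Ω, hm₂⟩ := ω.exists_domain_mem_cls hΩ (hVΩ hp') hm₁
  obtain ⟨W, hW, hpW, hWU, hd, hz⟩ :=
    ω.compat p' (hVΩ hp') p hp U₂ f₁ V h hU₂ hV hU₂Ω hVΩ hm₂ hm p' ⟨hpU₂, hp'⟩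
  rw [e]
  exact ⟨⟨hl.1, hp', hl.2.2⟩, W, hW, hpW, fun q hq => ⟨hU₂₁ (hWU hq).1, (hWU hq).2⟩, hd, hz⟩

/-- A vectorial function on `Ω` whose stem function is a nonzero real multiple of a unit field
aligned with `ω` belongs to `ω`. -/
lemma mem_cls_of_aligned (hΩ : IsAxDomain Ω) (hω : ¬ ω.IsNull) {v : ℂ → Fin 3 → ℂ}
    (hv : IsHoloStem (sliceSet unitI Ω) v)
    (hv1 : ∀ z ∈ sliceSet unitI Ω, v z ⬝ᵥ v z = 1 ∧ ω.Aligned z v) {r : ℝ} (hr : r ≠ 0)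
    {w : Quaternion ℝ → Quaternion ℝ} (hw : Induces Ω (fun z => ofVec ((r : ℂ) • v z)) w)
    {p : Quaternion ℝ} (hp : p ∈ Ω) : (Ω, w) ∈ ω.cls p := by
  have hrv : IsHoloStem (sliceSet unitI Ω) fun z => (r : ℂ) • v z := (isHoloStem_const _ r).smul hv
  obtain ⟨U, h, hl, e⟩ := ω.isClass p hp
  have hm : (U, h) ∈ ω.cls p := by rw [e]; exact ⟨hl, EquivAt.refl hl⟩
  obtain ⟨V, hV, hpV, hVU, hVΩ, hmV⟩ := ω.exists_domain_mem_cls hΩ.1 hp hm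
  have hzV := (sliceCoord_mem_iff hV.1.2).2 hpV
  have hsub : sliceSet unitI V ⊆ sliceSet unitI Ω := fun y hy => hVΩ hy
  have hmV' := mem_cls_of_mem_domain hΩ.1 hp hV hVΩ hmV hzV
  obtain ⟨H, hH, hHh⟩ := exists_vec_stem hV.1.2 (SRVec.mono hl.1.2 hV.1.2 hVU hl.2.2)
  have hvV := hv.mono hsub
  have hK' := (hH.dotProduct hvV).smul hvV
  have hK : IsHoloStem (sliceSet unitI V) fun y => H y - (H y ⬝ᵥ v y) • v y :=
    ⟨hH.1.sub hK'.1, fun y hy => by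
      have h1 := hH.2 y hy
      have h2 := hK'.2 y hy
      simp only at h2 ⊢
      rw [star_sub, ← h2, h1]⟩
  -- Alignment gives the vanishing only near one point; the identity theorem spreads it over `V`.
  -- With this, the coefficients `r` and `-(H ⬝ v)` annihilate the pair `H`, `r v`.
  have hpar : ∀ y ∈ sliceSet unitI V, H y - (H y ⬝ᵥ v y) • v y = 0 := by
    by_contra! hcon
    have h1 := hK.eventually_ne_zero hV hcon hzV
    have h2 := ((hv1 _ (hsub hzV)).2 V h H hmV' hH hHh).filter_mono
      (nhdsWithin_le_nhds (s := {sliceCoord p}ᶜ))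
    obtain ⟨y, hy1, hy2⟩ := (h1.and h2).exists
    exact hy1 (sub_eq_zero.2 hy2)
  rw [e]
  refine ⟨⟨hΩ.1, hp, mem_SRVec_of_induces hΩ.1.2 hrv hw⟩, V, hV, hpV,
    fun q hq => ⟨hVU hq, hVΩ hq⟩, (linDep_iff hV.1.2 hHh (hw.mono hVΩ)).2
    ⟨fun _ => (r : ℂ), fun y => ((-1 : ℝ) : ℂ) * (H y ⬝ᵥ v y), isHoloStem_const _ r,
      (isHoloStem_const _ (-1)).mul (hH.dotProduct hvV),
      ⟨_, hzV, Or.inl (Complex.ofReal_ne_zero.2 hr)⟩, fun y hy => ?_⟩, iff_of_false ?_ ?_⟩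
  · have := sub_eq_zero.1 (hpar y hy)
    nth_rewrite 1 [this]
    push_cast
    module
  · rw [← NullAt.of_mem hΩ.1 hp hV hVΩ hmV hpV]
    exact not_nullAt hΩ hω hp
  · rw [(hw.mono hVΩ).zero_iff hV.1.2]
    intro h0
    have h1 := ofVec_eq_zero.1 (h0 _ hzV)
    have h2 := (smul_eq_zero.1 h1).resolve_left (by exact_mod_cast hr)
    have h3 := (hv1 _ (hsub hzV)).1
    simp [h2] at h3

end VectorialClass

lemma induces_vecPart {Ω : Set (Quaternion ℝ)} (hΩ : AxiallySymmetric Ω) {L : ℂ → ℂ}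
    {H : ℂ → Fin 3 → ℂ} (hL : IsHoloStem (sliceSet unitI Ω) L) {f : Quaternion ℝ → Quaternion ℝ}
    (hf : Induces Ω (fun z => (L z : Quaternion ℂ) + ofVec (H z)) f) :
    Induces Ω (fun z => ofVec (H z)) (vecPart f) := by
  have hre {z} (hz : z ∈ sliceSet unitI Ω) : (stem f z).re = L z := by
    rw [stem_eq hf hz]; simp
  have hs : Induces Ω (fun z => (L z : Quaternion ℂ)) (scalarPart f) := by
    refine Induces.congr (F := fun z => ((stem f z).re : Quaternion ℂ)) ?_ fun z hz => by rw [hre hz]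
    apply induces_induced
    intro z hz
    have hz' : starRingEnd ℂ z ∈ sliceSet unitI Ω := (star_mem_iff hΩ).2 hz
    have := hL.2 z hz
    rw [Complex.star_def] at this
    simp only [hre hz, hre hz', this, conjC_coe, Complex.star_def]
  intro z hz J hJ
  rw [vecPart, hf z hz J hJ, hs z hz J hJ, phi_add, add_sub_cancel_left]

/-- A nowhere vanishing function in `𝒮ℛ_ℝ(Ω)` has a `*`-logarithm in `𝒮ℛ_ω(Ω)`, if `ω` is a nonnull
class without zeros on the basic domain `Ω`. -/
theorem exists_isStarLog_mem_SRClass {Ω : Set (Quaternion ℝ)} (hΩ : IsBasicDomain Ω)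
    {g : Quaternion ℝ → Quaternion ℝ} (hg : g ∈ SRReal Ω) (hg0 : ∀ q ∈ Ω, g q ≠ 0)
    {ω : VectorialClass Ω} (hω : ¬ ω.IsNull) (hZ : ω.zeroSet ∩ Ω = ∅) :
    ∃ f ∈ SRClass ω, IsStarLog Ω f g := by
  have hsymm := hΩ.1.1.2
  have hD := isOpen_sliceSet hΩ.1.1.1 unitI
  obtain ⟨G, hG, hGg⟩ := exists_scalar_stem hsymm hg
  have hG0 : ∀ z ∈ sliceSet unitI Ω, G z ≠ 0 := fun z hz h => hg0 _ hz (by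
    rw [hGg z hz _ unitI_mem, phi_coe, slicePoint_eq_zero_iff unitI_mem, h])
  have hstar : ∀ z ∈ sliceSet unitI Ω, star z ∈ sliceSet unitI Ω :=
    fun z hz => (star_mem_iff hsymm).2 hz
  have hreal_case {L : ℂ → ℂ} (hL : IsHoloStem (sliceSet unitI Ω) L)
      (hLG : ∀ z ∈ sliceSet unitI Ω, Complex.exp (L z) = G z) :
      ∃ f ∈ SRClass ω, IsStarLog Ω f g := by
    obtain ⟨f, hf, hfg⟩ := exists_isStarLog_SRReal hsymm hGg hL hLG
    exact ⟨f, ⟨hf.1, Or.inr hf⟩, hfg⟩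
  by_cases hx : ∃ x ∈ sliceSet unitI Ω, star x = x
  · obtain ⟨x, hx, hxr⟩ := hx
    have hsc := hΩ.isSimplyConnected_sliceSet hx hxr
    have hGx : G x = ((G x).re : ℂ) := by
      have := hG.2 x hx
      rw [hxr] at this
      exact (Complex.conj_eq_iff_re.1 this.symm).symm
    have hre : (G x).re ≠ 0 := fun h => hG0 x hx (by rw [hGx, h, Complex.ofReal_zero])
    rcases hre.lt_or_gt with hneg | hpos
    -- No slice-preserving logarithm exists here: it would be real at `x`, with positive
    -- exponential. The sign is moved into `exp (π v) = -1`.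
    · have hG' : IsHoloStem (sliceSet unitI Ω) fun z => -G z :=
        ⟨hG.1.neg, fun z hz => by simp only [hG.2 z hz, star_neg]⟩
      obtain ⟨L, hL, hLG⟩ := exists_log_stem_of_pos hD hsc hstar hG'
        (fun z hz => neg_ne_zero.2 (hG0 z hz)) hx hxr (neg_pos.2 hneg) (by
          rw [Complex.ofReal_neg, ← hGx])
      obtain ⟨v, hv, hv1⟩ := VectorialClass.exists_unit_stem hΩ.1 hω hZ hsc hx hxr
      have hpv : IsHoloStem (sliceSet unitI Ω) fun z => (Real.pi : ℂ) • v z :=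
        (isHoloStem_const _ Real.pi).smul hv
      have hF := isStem_coe_add_ofVec hL hpv
      have hf := induces_induced hF
      refine ⟨_, ⟨mem_SR_of_induces hL hpv hf, Or.inl fun p hp => ?_⟩,
        isStarLog_add_pi hsymm hGg hF hf hLG fun z hz => (hv1 z hz).1⟩
      exact VectorialClass.mem_cls_of_aligned hΩ.1 hω hv hv1 Real.pi_ne_zero
        (induces_vecPart hsymm hL hf) hp
    · obtain ⟨L, hL, hLG⟩ := exists_log_stem_of_pos hD hsc hstar hG hG0 hx hxr hpos hGx
      exact hreal_case hL hLG
  · have hreal : ∀ z ∈ sliceSet unitI Ω, z.im ≠ 0 := fun z hz h =>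
      hx ⟨z, hz, Complex.conj_eq_iff_im.2 h⟩
    have hup : IsOpen {z : ℂ | 0 < z.im} := isOpen_lt continuous_const Complex.continuous_im
    -- Without real points there is no sign condition on `G`: any logarithm on the upper half
    -- extends by reflection.
    obtain ⟨L, hL, hLG⟩ := exists_log (hD.inter hup) (hΩ.isSimplyConnected_upper hreal)
      (hG.1.mono Set.inter_subset_left) fun z hz => hG0 z hz.1
    refine hreal_case (isHoloStem_symmetrize hD hstar hreal hL) fun z hz => ?_
    rcases (hreal z hz).lt_or_gt with h | h
    · have h1 := hLG (star z) ⟨hstar z hz, by simpa using h⟩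
      simp only [symmetrize, h.le.not_gt, if_false]
      rw [Complex.star_def, Complex.exp_conj, ← Complex.star_def, h1, hG.2 z hz, star_star]
    · simp only [symmetrize, h, if_true]
      exact hLG z ⟨hz, h⟩

end SliceReg

end

theorem mainTheorem3 (Ω : Set (Quaternion ℝ)) (hΩ : SliceReg.IsBasicDomain Ω)
    (g : Quaternion ℝ → Quaternion ℝ) (hg : g ∈ SliceReg.SRReal Ω) (hg0 : ∀ q ∈ Ω, g q ≠ 0)
    (ω : SliceReg.VectorialClass Ω) (hω : ¬ ω.IsNull) (hZ : ω.zeroSet ∩ Ω = ∅) :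
    ∃ f ∈ SliceReg.SRClass ω, SliceReg.IsStarLog Ω f g :=
  SliceReg.exists_isStarLog_mem_SRClass hΩ hg hg0 hω hZ
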